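/- Let $d,n\ge 0$ be integers, $\|\cdot\|$ the Euclidean norm, $\mathcal K=\{x\in\mathbb R^d:\|x\|\le 1\}$, and write $\|v\|_A^2=v^\top Av$. For symmetric matrices, $A\preceq B$ means that $B-A$ is positive semidefinite. **Loss.** Let $\beta>0$, $G\ge 0$, $x_\star\in\mathcal K$, and let $f:\mathbb R^d\to\mathbb R$ be $G$-Lipschitz with $\sup_{x\in\mathcal K}|f(x)|\le 1$, minimized over $\mathcal K$ at $x_\star$, such that $x\mapsto f(x)-\beta\|x-x_\star\|$ is convex on $\mathbb R^d$ and $f(x_\star+x)=f(x_\star-x)$ for all $x\in\mathbb R^d$. **Algorithm.** Let $\lambda,\eta,\sigma>0$. Put $\mu_1=0$, $\Sigma_1=\sigma^2\mathbf I_d$, $Y_0=0$. In round $t=1,\dots,n$ the learner samples $X_t\sim\mathcal N(\mu_t,\Sigma_t)$ (conditionally on $X_1,Y_1,\dots,X_{t-1},Y_{t-1}$), with density $p_t$, and observes $Y_t=f(X_t)+\varepsilon_t$, where, given $X_1,Y_1,\dots,X_{t-1},Y_{t-1},X_t$, the noise $\varepsilon_t$ is $\|X_t-x_\star\|$-subgaussian,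 that is, $\mathbb E[e^{s\varepsilon_t}\mid X_1,Y_1,\dots,X_{t-1},Y_{t-1},X_t]\le e^{s^2\|X_t-x_\star\|^2/2}$ for all $s\in\mathbb R$. With $Z_t=Y_t-Y_{t-1}$ and $R_t=\dfrac{p_t\left(\frac{X_t-\lambda\mu_t}{1-\lambda}\right)}{(1-\lambda)^d\,p_t(X_t)}$, set $$g_t=\frac{R_tZ_t}{(1-\lambda)^2}\Sigma_t^{-1}(X_t-\mu_t),\qquad H_t=\frac{\lambda R_tZ_t}{(1-\lambda)^2}\left[\frac{\Sigma_t^{-1}(X_t-\mu_t)(X_t-\mu_t)^\top\Sigma_t^{-1}}{(1-\lambda)^2}-\Sigma_t^{-1}\right],$$ $$\Sigma_{t+1}^{-1}=\Sigma_t^{-1}+\tfrac{\eta}{2}H_t,\qquad \mu_{t+1}=\arg\min_{\mu\in\mathcal K}\left\|\mu-[\mu_t-\eta\Sigma_{t+1}g_t]\right\|_{\Sigma_{t+1}^{-1}}.$$ (The algorithm is defined as long as the matrices $\Sigma_t$ are positive definite.) **Stopping time.** Let $L>0$. Let $s_t(x)=\mathbb E\left[(1-\tfrac1\lambda)f(X)+\tfrac1\lambda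 f((1-\lambda)X+\lambda x)\right]$, where the expectation is over $X\sim\mathcal N(\mu_t,\Sigma_t)$ with $(\mu_t,\Sigma_t)$ held fixed, and let $\bar\Sigma_t^{-1}=\Sigma_1^{-1}+\frac\eta2\sum_{u=1}^{t-1}\nabla^2s_u(\mu_u)$. Let $\tau$ be the first round $t\in\{1,\dots,n\}$ for which at least one of the following three conditions fails, and $\tau=n$ if there is no such round: (a) $\frac12\|\mu_{t+1}-x_\star\|^2_{\Sigma_{t+1}^{-1}}\le\frac{1}{2\lambda^2L^2}$; (b) $\Sigma_{t+1}$ is positive definite; (c) $\frac12\bar\Sigma_{t+1}^{-1}\preceq\Sigma_{t+1}^{-1}\preceq\frac32\bar\Sigma_{t+1}^{-1}$. **Claim.** Suppose that $\lambda\le 1-\frac1{\sqrt2}$, $0<\kappa\le1$ and $\sigma^{-2}\ge\max\{\Theta,1\}$, where $$\Theta=\frac{1}{32}\,\lambda^{2-\kappa}\,\beta^{2-\kappa}\,\eta^{2-\kappa}\,6^{-\frac{d(2-\kappa)}{2}}\,e^{-\frac{2-\kappa}{\lambda^2L^2}}.$$ Then for all $1\le t\le\tau$, $$\Sigma_t^{-1}\succeq\frac{\Theta}{16}\,t^{2-\kappa}\,\mathbf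 I_d .$$ In words, the precision matrix grows at a rate arbitrarily close to quadratic. -/

import Mathlib

open MeasureTheory ProbabilityTheory

noncomputable section

/-- The Euclidean space `ℝ^d`. -/
abbrev Vec (d : ℕ) : Type := EuclideanSpace ℝ (Fin d)

/-- Real `d × d` matrices. -/
abbrev Mat (d : ℕ) : Type := Matrix (Fin d) (Fin d) ℝ

/-- The action set `𝒦`, i.e. the closed Euclidean unit ball. -/
def actionSet (d : ℕ) : Set (Vec d) := Metric.closedBall 0 1

/-- `A v`, as a vector of the Euclidean space. -/
def mulV {d : ℕ} (A : Mat d) (v : Vec d) : Vec d := WithLp.toLp 2 (A.mulVec v.ofLp)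

/-- `‖v‖_A ^ 2 = vᵀ A v`. -/
def normSqWrt {d : ℕ} (A : Mat d) (v : Vec d) : ℝ := v.ofLp ⬝ᵥ A.mulVec v.ofLp

/-- The outer product `v vᵀ`. -/
def outer {d : ℕ} (v : Vec d) : Mat d := Matrix.vecMulVec v.ofLp v.ofLp

/-- The Loewner order `A ⪯ B`. -/
def LoewnerLE {d : ℕ} (A B : Mat d) : Prop := (B - A).PosSemidef

/-! ### The loss function -/

/-- `(β, ℓ)`-convexity of `f` on `K`, with respect to the point `xs` (the minimizer of `f`). -/
def IsBetaEllConvexOn {d : ℕ} (β ℓ : ℝ) (K : Set (Vec d)) (f : Vec d → ℝ) (xs : Vec d) : Prop :=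
  0 < β ∧ 1 ≤ ℓ ∧ ConvexOn ℝ K (fun x => f x - β * ‖x - xs‖ ^ ℓ)

/-- The assumptions on the loss function: `(β, 1)`-convex on `ℝ^d` with minimizer `xs` in the unit
ball, `G`-Lipschitz on `ℝ^d`, bounded by `1` in absolute value on the unit ball, and symmetric
with respect to `xs`. -/
structure IsAdmissibleLoss {d : ℕ} (β G : ℝ) (f : Vec d → ℝ) (xs : Vec d) : Prop where
  convex : IsBetaEllConvexOn β 1 Set.univ f xs
  minimizer_mem : xs ∈ actionSet d
  minimizer : ∀ x ∈ actionSet d, f xs ≤ f x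
  lipschitz : ∀ x y, |f x - f y| ≤ G * ‖x - y‖
  bounded : ∀ x ∈ actionSet d, |f x| ≤ 1
  symmetric : ∀ x, f (xs + x) = f (xs - x)

/-! ### The algorithm -/

/-- The density at `x` of the Gaussian law with mean `m` and precision matrix (inverse covariance)
`P`. -/
def gaussDensity {d : ℕ} (m : Vec d) (P : Mat d) (x : Vec d) : ℝ :=
  Real.sqrt (P.det / (2 * Real.pi) ^ d) * Real.exp (-(normSqWrt P (x - m)) / 2)

/-- The importance weight
`R = p ((x - lam m) / (1 - lam)) / ((1 - lam) ^ d * p x)`. -/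
def impWeight {d : ℕ} (lam : ℝ) (m : Vec d) (P : Mat d) (x : Vec d) : ℝ :=
  gaussDensity m P ((1 - lam)⁻¹ • (x - lam • m)) / ((1 - lam) ^ d * gaussDensity m P x)

/-- The gradient estimator `g`; here `P` is the precision matrix. -/
def gradEst {d : ℕ} (lam : ℝ) (m : Vec d) (P : Mat d) (x : Vec d) (z : ℝ) : Vec d :=
  (impWeight lam m P x * z / (1 - lam) ^ 2) • mulV P (x - m)

/-- The Hessian estimator `H`; here `P` is the precision matrix. -/
def hessEst {d : ℕ} (lam : ℝ) (m : Vec d) (P : Mat d) (x : Vec d) (z : ℝ) : Mat d :=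
  (lam * impWeight lam m P x * z / (1 - lam) ^ 2) •
    (((1 - lam) ^ 2)⁻¹ • (P * outer (x - m) * P) - P)

/-- A minimizer over `𝒦` of `m ↦ ‖m - y‖_P` (equivalently, of its square). It exists by
compactness, and it is unique when `P` is positive definite. -/
def projAction {d : ℕ} (P : Mat d) (y : Vec d) : Vec d :=
  Classical.epsilon fun m => m ∈ actionSet d ∧
    ∀ z ∈ actionSet d, normSqWrt P (m - y) ≤ normSqWrt P (z - y)

theorem projAction_spec {d : ℕ} (P : Mat d) (y : Vec d) :
    projAction P y ∈ actionSet d ∧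
      ∀ z ∈ actionSet d, normSqWrt P (projAction P y - y) ≤ normSqWrt P (z - y) := by
  apply Classical.epsilon_spec
    (p := fun m => m ∈ actionSet d ∧
      ∀ z ∈ actionSet d, normSqWrt P (m - y) ≤ normSqWrt P (z - y))
  have hc : Continuous fun m : Vec d => normSqWrt P (m - y) := by
    unfold normSqWrt
    fun_prop
  obtain ⟨m, hm, hmin⟩ := (isCompact_closedBall (0 : Vec d) 1).exists_isMinOn
    ⟨0, by simp⟩ hc.continuousOn
  exact ⟨m, hm, fun z hz => hmin hz⟩

/-- The state of the algorithm at the beginning of a round: the mean `μ_t` and the precision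
matrix `Σ_t⁻¹`. -/
structure NewtonState (d : ℕ) where
  mean : Vec d
  prec : Mat d

/-- The observed losses: `Y_0 = 0`, and `Y_t = f (X_t) + ε_t` for `t ≥ 1`. -/
def obs {d : ℕ} (f : Vec d → ℝ) (x : ℕ → Vec d) (ε : ℕ → ℝ) (t : ℕ) : ℝ :=
  if t = 0 then 0 else f (x t) + ε t

/-- The state of the online Newton method at the beginning of round `t`, along the sequence `x` of
actions and `y` of observed losses. Rounds are numbered from `1`; the value at `0` is a
convention. -/
def newtonState {d : ℕ} (lam η σ : ℝ) (x : ℕ → Vec d) (y : ℕ → ℝ) : ℕ → NewtonState d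
  | 0 => ⟨0, (σ ^ 2)⁻¹ • (1 : Mat d)⟩
  | 1 => ⟨0, (σ ^ 2)⁻¹ • (1 : Mat d)⟩
  | t + 2 =>
    let S := newtonState lam η σ x y (t + 1)
    let z := y (t + 1) - y t
    let P : Mat d := S.prec + (η / 2) • hessEst lam S.mean S.prec (x (t + 1)) z
    ⟨projAction P (S.mean - η • mulV P⁻¹ (gradEst lam S.mean S.prec (x (t + 1)) z)), P⟩

/-! ### The surrogate loss and the stopping time -/

/-- The surrogate
`s(x) = 𝔼[(1 - 1/lam) f(X) + (1/lam) f((1 - lam) X + lam x)]`, where `X ∼ 𝒩(m, S)`. -/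
def surrogate {d : ℕ} (f : Vec d → ℝ) (lam : ℝ) (m : Vec d) (S : Mat d) (x : Vec d) : ℝ :=
  ∫ X, ((1 - 1 / lam) * f X + (1 / lam) * f ((1 - lam) • X + lam • x)) ∂(multivariateGaussian m S)

/-- The Hessian matrix of `g` at `x`. -/
def hessianMat {d : ℕ} (g : Vec d → ℝ) (x : Vec d) : Mat d :=
  Matrix.of fun i j =>
    fderiv ℝ (fderiv ℝ g) x (EuclideanSpace.single i 1) (EuclideanSpace.single j 1)

/-- `Σ̄_t⁻¹ = Σ_1⁻¹ + (η / 2) ∑_{1 ≤ u < t} ∇² s_u(μ_u)`, where `s_u` is the surrogate with respect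
to `𝒩(μ_u, Σ_u)`; `st u` is the state `(μ_u, Σ_u⁻¹)`. -/
def meanPrec {d : ℕ} (f : Vec d → ℝ) (lam η σ : ℝ) (st : ℕ → NewtonState d) (t : ℕ) : Mat d :=
  (σ ^ 2)⁻¹ • (1 : Mat d) + (η / 2) • ∑ u ∈ Finset.Ico 1 t,
    hessianMat (surrogate f lam (st u).mean (st u).prec⁻¹) (st u).mean

/-- The conditions monitored by the stopping time, at the state of round `t`:
(a) `½ ‖μ_t - xs‖²_{Σ_t⁻¹} ≤ 1 / (2 lam² L²)`; (b) `Σ_t` is positive definite;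
(c) `½ Σ̄_t⁻¹ ⪯ Σ_t⁻¹ ⪯ (3/2) Σ̄_t⁻¹`. -/
def GoodState {d : ℕ} (f : Vec d → ℝ) (xs : Vec d) (lam η σ L : ℝ) (st : ℕ → NewtonState d)
    (t : ℕ) : Prop :=
  (1 / 2) * normSqWrt (st t).prec ((st t).mean - xs) ≤ 1 / (2 * lam ^ 2 * L ^ 2) ∧
  (st t).prec.PosDef ∧
  LoewnerLE ((1 / 2 : ℝ) • meanPrec f lam η σ st t) (st t).prec ∧
  LoewnerLE (st t).prec ((3 / 2 : ℝ) • meanPrec f lam η σ st t)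

open scoped Classical in
/-- `τ`: the first round `t ∈ {1, …, n}` such that the state of round `t + 1` is not good, and `n`
if there is no such round. -/
def stoppingRound (n : ℕ) (good : ℕ → Prop) : ℕ :=
  if h : ∃ t, 1 ≤ t ∧ t ≤ n ∧ ¬ good (t + 1) then Nat.find h else n

/-! ### The interaction with the environment -/

/-- The information available before the action of round `t` is chosen: the σ-algebra generated by
`X_1, Y_1, …, X_{t-1}, Y_{t-1}`. -/
abbrev historyBefore {Ω : Type*} {d : ℕ} (X : ℕ → Ω → Vec d) (Y : ℕ → Ω → ℝ) (t : ℕ) :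
    MeasurableSpace Ω :=
  ⨆ s ∈ Finset.Ico 1 t,
    (MeasurableSpace.comap (X s) inferInstance ⊔ MeasurableSpace.comap (Y s) inferInstance)

/-- `W` is conditionally `c`-subgaussian given `m`, for an `m`-measurable random variable `c`:
`𝔼[exp (s W) | m] ≤ exp (s² c² / 2)` for all real `s`. The inequality of conditional expectations
is written by integrating over the events of `m`, because `exp (s W)` need not be integrable; it
forces `W` to have conditional mean zero given `m`. -/
def IsCondSubgaussian {Ω : Type*} {m0 : MeasurableSpace Ω} (Pr : Measure Ω) (m : MeasurableSpace Ω)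
    (W c : Ω → ℝ) : Prop :=
  ∀ s : ℝ, ∀ B : Set Ω, MeasurableSet[m] B →
    ∫⁻ ω in B, ENNReal.ofReal (Real.exp (s * W ω)) ∂Pr ≤
      ∫⁻ ω in B, ENNReal.ofReal (Real.exp (s ^ 2 * c ω ^ 2 / 2)) ∂Pr

/-- The losses observed along the random actions `X` with noise `ε`. -/
def obsProc {Ω : Type*} {d : ℕ} (f : Vec d → ℝ) (X : ℕ → Ω → Vec d) (ε : ℕ → Ω → ℝ)
    (t : ℕ) (ω : Ω) : ℝ :=
  obs f (fun s => X s ω) (fun s => ε s ω) t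

/-- The random states `(μ_t, Σ_t⁻¹)` of the algorithm. -/
def stateProc {Ω : Type*} {d : ℕ} (f : Vec d → ℝ) (lam η σ : ℝ) (X : ℕ → Ω → Vec d)
    (ε : ℕ → Ω → ℝ) (ω : Ω) : ℕ → NewtonState d :=
  newtonState lam η σ (fun s => X s ω) (fun s => obsProc f X ε s ω)

/-- The actions `X_1, …, X_n` and noises `ε_1, …, ε_n` come from running the algorithm for `n`
rounds on the loss `f`, with any query of `ℝ^d` allowed.
* As long as the covariance matrices have stayed positive definite, the conditional law of `X_t`
  given the history before round `t` is `𝒩(μ_t, Σ_t)`. (Otherwise the algorithm is undefined, and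
  nothing is required of `X_t`.)
* Given that history and `X_t`, the noise `ε_t` is `‖X_t - xs‖`-subgaussian. -/
structure IsNewtonRun {Ω : Type*} [MeasurableSpace Ω] (Pr : Measure Ω) {d : ℕ} (f : Vec d → ℝ)
    (xs : Vec d) (lam η σ : ℝ) (n : ℕ) (X : ℕ → Ω → Vec d) (ε : ℕ → Ω → ℝ) : Prop where
  measurable_action : ∀ t, Measurable (X t)
  measurable_noise : ∀ t, Measurable (ε t)
  sampling : ∀ t, 1 ≤ t → t ≤ n → ∀ A : Set (Vec d), MeasurableSet A →
    ∀ᵐ ω ∂Pr, (∀ s, 1 ≤ s → s ≤ t → (stateProc f lam η σ X ε ω s).prec.PosDef) →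
      (Pr⟦X t ⁻¹' A | historyBefore X (obsProc f X ε) t⟧) ω =
        (multivariateGaussian (stateProc f lam η σ X ε ω t).mean
          (stateProc f lam η σ X ε ω t).prec⁻¹).real A
  noise : ∀ t, 1 ≤ t → t ≤ n →
    IsCondSubgaussian Pr
      (historyBefore X (obsProc f X ε) t ⊔ MeasurableSpace.comap (X t) inferInstance)
      (ε t) (fun ω => ‖X t ω - xs‖)

/-- `Θ = (lam β η)^(2-κ) 6^(-d(2-κ)/2) exp (-(2-κ)/(lam² L²)) / 32`. -/
def growthConst (d : ℕ) (lam β η κ L : ℝ) : ℝ :=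
  lam ^ (2 - κ) * β ^ (2 - κ) * η ^ (2 - κ) * (6 : ℝ) ^ (-((d : ℝ) * (2 - κ) / 2)) *
    Real.exp (-((2 - κ) / (lam ^ 2 * L ^ 2))) / 32

end

/-! The argument is pathwise. The loss is at least as curved as the cone `β‖x - xs‖`. Up to an
additive constant, the surrogate is `1/lam` times a smoothing of `f` by a Gaussian of covariance `(1
- lam)² P⁻¹`, evaluated at `(1 - lam) m + lam x`. If the precision `P` is at least `p I`, the
smoothing has width at most about `p^(-1/2)`, and a cone smoothed at that width has curvature of
order `√p`, reduced by `exp (-‖m - xs‖²_P / (2 (1 - lam)²))` because the mean may miss the tip. This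
is `le_normSqWrt_hessianMat_surrogate`.

Since `f` is not assumed smooth, the curvature is read off second differences
(`le_fderiv_fderiv_of_second_difference`). Those of `f` dominate `β` times those of the norm. The
norm is a multiple of the average of `|⟨·, g⟩|` over Gaussian `g`, so everything reduces to a second
difference of `|x|` under a Gaussian on the line. Smoothness of the surrogate comes from
Cameron–Martin, which moves the shift from `f` into an exponential weight.

Before stopping, condition (a) bounds the exponential factor and (c) gives `P_t ⪰ ½ Σ̄_t⁻¹`. A lower
bound `p_u` on each earlier precision thus yields `p_t ≥ σ⁻²/2 + (A/4) ∑ √p_u` with `A =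
growthRate`. This discrete form of `p' = c √p` has quadratic growth, and `growth_recursion` closes
the strong induction. -/

open scoped NNReal MatrixOrder

universe u

/-! ### Auxiliary facts on Gaussian measures -/

/-- **Cameron–Martin formula** for the standard Gaussian measure. -/
theorem stdGaussian_map_add_left {d : ℕ} (h : Vec d) :
    (stdGaussian (Vec d)).map (fun w => h + w) =
      (stdGaussian (Vec d)).withDensity
        (fun w => ENNReal.ofReal (Real.exp (inner ℝ h w - ‖h‖ ^ 2 / 2))) := by
  have key : ∀ t : Vec d, ∫ w, Complex.exp (inner ℝ h w + inner ℝ w t * Complex.I)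
      ∂(stdGaussian (Vec d)) =
      Complex.exp (∑ i, ((h i : ℂ) + t i * Complex.I) ^ 2 / 2) := by
    intro t
    rw [← map_pi_eq_stdGaussian, integral_map (by fun_prop)
      (Measurable.aestronglyMeasurable (by fun_prop))]
    have hprod : ∀ x : Fin d → ℝ, Complex.exp (inner ℝ h (WithLp.toLp 2 x : Vec d) +
        inner ℝ (WithLp.toLp 2 x : Vec d) t * Complex.I) =
        ∏ i, Complex.exp (((h i : ℂ) + t i * Complex.I) * (x i : ℝ)) := by
      intro x
      rw [← Complex.exp_sum]
      congr 1
      simp only [PiLp.inner_apply, RCLike.inner_apply, conj_trivial, Complex.ofReal_sum,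
        Complex.ofReal_mul, Finset.sum_mul, ← Finset.sum_add_distrib]
      exact Finset.sum_congr rfl fun i _ => by ring
    simp_rw [hprod]
    rw [integral_fintype_prod_eq_prod
      (f := fun i (x : ℝ) => Complex.exp (((h i : ℂ) + t i * Complex.I) * (x : ℝ))),
      Complex.exp_sum]
    refine Finset.prod_congr rfl fun i _ => ?_
    have := complexMGF_id_gaussianReal (μ := 0) (v := 1) ((h i : ℂ) + t i * Complex.I)
    simpa [complexMGF] using this
  have hint : Integrable (fun w : Vec d => Real.exp (inner ℝ h w - ‖h‖ ^ 2 / 2))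
      (stdGaussian (Vec d)) := by
    -- The Bochner integral of a non-integrable function is `0`, whereas `key 0` evaluates this one
    -- as an exponential.
    by_contra hcon
    have h0 := key 0
    have h1 : ∫ w, Real.exp (inner ℝ h w) ∂(stdGaussian (Vec d)) = 0 := by
      refine integral_undef fun hi => hcon ?_
      simp_rw [Real.exp_sub]
      exact hi.div_const _
    simp only [inner_zero_right, Complex.ofReal_zero, zero_mul, add_zero,
      ← Complex.ofReal_exp, integral_complex_ofReal, h1] at h0
    exact Complex.exp_ne_zero _ h0.symm
  have : IsFiniteMeasure ((stdGaussian (Vec d)).withDensity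
      (fun w => ENNReal.ofReal (Real.exp (inner ℝ h w - ‖h‖ ^ 2 / 2)))) :=
    isFiniteMeasure_withDensity_ofReal hint.2
  have hmap : IsProbabilityMeasure ((stdGaussian (Vec d)).map (fun w => h + w)) :=
    Measure.isProbabilityMeasure_map (by fun_prop)
  apply Measure.ext_of_charFun (E := Vec d)
  ext t
  rw [charFun_apply, charFun_apply, integral_map (by fun_prop)
    (Measurable.aestronglyMeasurable (by fun_prop)),
    integral_withDensity_eq_integral_toReal_smul (by fun_prop) (by simp)]
  have e1 : ∀ w : Vec d, Complex.exp (inner ℝ (h + w) t * Complex.I) =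
      Complex.exp (inner ℝ h t * Complex.I) * Complex.exp (inner ℝ w t * Complex.I) := by
    intro w
    rw [← Complex.exp_add, inner_add_left]
    push_cast
    ring_nf
  have e2 : ∀ w : Vec d, (ENNReal.ofReal (Real.exp (inner ℝ h w - ‖h‖ ^ 2 / 2))).toReal •
      Complex.exp (inner ℝ w t * Complex.I) = Complex.exp (-‖h‖ ^ 2 / 2) *
        Complex.exp (inner ℝ h w + inner ℝ w t * Complex.I) := by
    intro w
    rw [ENNReal.toReal_ofReal (Real.exp_pos _).le, Complex.real_smul, Complex.ofReal_exp,
      ← Complex.exp_add, ← Complex.exp_add]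
    push_cast
    ring_nf
  simp_rw [e1, e2, integral_const_mul, key]
  have h2 := charFun_stdGaussian (E := Vec d) t
  rw [charFun_apply] at h2
  rw [h2, ← Complex.exp_add, ← Complex.exp_add]
  congr 1
  rw [← Complex.ofReal_pow, ← Complex.ofReal_pow, EuclideanSpace.real_norm_sq_eq,
    EuclideanSpace.real_norm_sq_eq]
  simp only [PiLp.inner_apply, RCLike.inner_apply, conj_trivial, Complex.ofReal_sum,
        Complex.ofReal_mul, Finset.sum_mul, Complex.ofReal_pow, Finset.sum_div,
        ← Finset.sum_neg_distrib, ← Finset.sum_add_distrib]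
  refine Finset.sum_congr rfl fun i _ => ?_
  linear_combination (-(t i : ℂ) ^ 2 / 2) * Complex.I_sq

theorem integral_add_left_stdGaussian {d : ℕ} (h : Vec d) {k : Vec d → ℝ} (hk : Continuous k) :
    ∫ w, k (h + w) ∂(stdGaussian (Vec d)) = Real.exp (-(‖h‖ ^ 2 / 2)) *
      ∫ w, Real.exp (inner ℝ h w) * k w ∂(stdGaussian (Vec d)) := by
  rw [← integral_map (φ := fun w => h + w) (f := k) (by fun_prop) hk.aestronglyMeasurable,
    stdGaussian_map_add_left, integral_withDensity_eq_integral_toReal_smul (by fun_prop) (by simp),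
    ← integral_const_mul]
  refine integral_congr_ae (.of_forall fun w => ?_)
  simp only [ENNReal.toReal_ofReal (Real.exp_pos _).le, smul_eq_mul]
  rw [sub_eq_add_neg, Real.exp_add]
  ring

/-- A Gaussian measure on a finite-dimensional space has all exponential moments. -/
theorem integrable_exp_mul_norm_stdGaussian {d : ℕ} (c : ℝ) :
    Integrable (fun w : Vec d => Real.exp (c * ‖w‖)) (stdGaussian (Vec d)) := by
  obtain ⟨C, hC, hi⟩ := IsGaussian.exists_integrable_exp_sq (stdGaussian (Vec d))
  refine (hi.const_mul (Real.exp (c ^ 2 / (4 * C)))).mono'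
    (Measurable.aestronglyMeasurable (by fun_prop)) (.of_forall fun w => ?_)
  rw [Real.norm_of_nonneg (Real.exp_pos _).le, ← Real.exp_add]
  apply Real.exp_le_exp.2
  have : c ^ 2 / (4 * C) + C * ‖w‖ ^ 2 - c * ‖w‖ = (c - 2 * C * ‖w‖) ^ 2 / (4 * C) := by
    field_simp
    ring
  have h2 : 0 ≤ (c - 2 * C * ‖w‖) ^ 2 / (4 * C) := by positivity
  linarith

/-! ### Smoothness of exponential integrals -/

theorem aestronglyMeasurable_innerSL_smulRight {E F : Type*} [NormedAddCommGroup E]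
    [InnerProductSpace ℝ E] [FiniteDimensional ℝ E] [MeasurableSpace E] [BorelSpace E]
    [NormedAddCommGroup F] [NormedSpace ℝ F]
    {ν : Measure E} {k : E → F} (hk : AEStronglyMeasurable k ν) :
    AEStronglyMeasurable (fun w => (innerSL ℝ w).smulRight (k w)) ν := by
  have hc : Continuous fun p : (E →L[ℝ] ℝ) × F => p.1.smulRight p.2 :=
    (ContinuousLinearMap.smulRightL ℝ E F).isBoundedBilinearMap.continuous
  exact hc.comp_aestronglyMeasurable
    (((innerSL ℝ).continuous.aestronglyMeasurable).prodMk hk)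

theorem hasFDerivAt_integral_exp_inner {E F : Type*} [NormedAddCommGroup E]
    [InnerProductSpace ℝ E] [FiniteDimensional ℝ E] [MeasurableSpace E] [BorelSpace E]
    [NormedAddCommGroup F] [NormedSpace ℝ F]
    (ν : Measure E) {k : E → F} (hk : AEStronglyMeasurable k ν)
    (hint : ∀ c : ℝ, Integrable (fun w => Real.exp (c * ‖w‖) * ‖k w‖) ν) (h₀ : E) :
    HasFDerivAt (fun h => ∫ w, Real.exp (inner ℝ h w) • k w ∂ν)
      (∫ w, Real.exp (inner ℝ h₀ w) • (innerSL ℝ w).smulRight (k w) ∂ν) h₀ := by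
  have hexp : ∀ h w : E, Real.exp (inner ℝ h w) ≤ Real.exp (‖h‖ * ‖w‖) := fun h w =>
    Real.exp_le_exp.2 (real_inner_le_norm h w)
  have hm : ∀ h : E, AEStronglyMeasurable (fun w => Real.exp (inner ℝ h w) • k w) ν := fun h =>
    (Measurable.aestronglyMeasurable (by fun_prop)).smul hk
  refine hasFDerivAt_integral_of_dominated_of_fderiv_le
    (F' := fun h w => Real.exp (inner ℝ h w) • (innerSL ℝ w).smulRight (k w))
    -- The `2` is `1` for the radius of the ball around `h₀`, plus `1` to absorb the factor `‖w‖ ≤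
    -- exp ‖w‖` produced by differentiation.
    (bound := fun w => Real.exp ((‖h₀‖ + 2) * ‖w‖) * ‖k w‖)
    (Metric.ball_mem_nhds h₀ one_pos) (.of_forall hm) ?_ ?_ ?_ (hint _) ?_
  · refine (hint ‖h₀‖).mono' (hm h₀) (.of_forall fun w => ?_)
    rw [norm_smul, Real.norm_of_nonneg (Real.exp_pos _).le]
    gcongr
    exact real_inner_le_norm _ _
  · exact AEStronglyMeasurable.smul (f := fun w => Real.exp (inner ℝ h₀ w))
      (Continuous.aestronglyMeasurable (by fun_prop)) (aestronglyMeasurable_innerSL_smulRight hk)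
  · refine .of_forall fun w h hh => ?_
    rw [norm_smul, Real.norm_of_nonneg (Real.exp_pos _).le, ContinuousLinearMap.norm_smulRight_apply,
      innerSL_apply_norm, ← mul_assoc]
    gcongr
    have h1 : ‖h‖ ≤ ‖h₀‖ + 1 := by
      have := norm_le_norm_add_norm_sub' h h₀
      rw [← dist_eq_norm] at this
      have := Metric.mem_ball.1 hh
      linarith
    calc Real.exp (inner ℝ h w) * ‖w‖ ≤ Real.exp ((‖h₀‖ + 1) * ‖w‖) * Real.exp ‖w‖ := by
          gcongr
          · exact (real_inner_le_norm h w).trans (by gcongr)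
          · linarith [Real.add_one_le_exp ‖w‖]
      _ = Real.exp ((‖h₀‖ + 2) * ‖w‖) := by rw [← Real.exp_add]; ring_nf
  · refine .of_forall fun w h _ => ?_
    have h1 : HasFDerivAt (fun h : E => inner ℝ h w) (innerSL ℝ w) h := by
      have := (innerSL ℝ w).hasFDerivAt (x := h)
      refine this.congr_of_eventuallyEq (.of_forall fun y => ?_)
      simp [real_inner_comm]
    have := h1.exp.smul_const (k w)
    convert this using 1
    ext
    simp [smul_smul]

/-- Differentiating replaces `k w` by `⟨w, ·⟩ k w`, which again has all exponential moments, so the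
induction runs with `F` replaced by `E →L[ℝ] F`. The common universe keeps that space an admissible
`F`. -/
theorem contDiff_integral_exp_inner {E F : Type u} [NormedAddCommGroup E]
    [InnerProductSpace ℝ E] [FiniteDimensional ℝ E] [MeasurableSpace E] [BorelSpace E]
    [NormedAddCommGroup F] [NormedSpace ℝ F] (n : ℕ)
    (ν : Measure E) {k : E → F} (hk : AEStronglyMeasurable k ν)
    (hint : ∀ c : ℝ, Integrable (fun w => Real.exp (c * ‖w‖) * ‖k w‖) ν) :
    ContDiff ℝ n (fun h => ∫ w, Real.exp (inner ℝ h w) • k w ∂ν) := by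
  induction n generalizing F with
  | zero =>
    exact contDiff_zero.2 (continuous_iff_continuousAt.2 fun h =>
      (hasFDerivAt_integral_exp_inner ν hk hint h).continuousAt)
  | succ n ih =>
    rw [Nat.cast_succ, contDiff_succ_iff_fderiv]
    refine ⟨fun h => (hasFDerivAt_integral_exp_inner ν hk hint h).differentiableAt, by simp, ?_⟩
    have hfd : fderiv ℝ (fun h => ∫ w, Real.exp (inner ℝ h w) • k w ∂ν) =
        fun h => ∫ w, Real.exp (inner ℝ h w) • (innerSL ℝ w).smulRight (k w) ∂ν :=
      funext fun h => (hasFDerivAt_integral_exp_inner ν hk hint h).fderiv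
    rw [hfd]
    refine ih (aestronglyMeasurable_innerSL_smulRight hk) fun c => ?_
    refine (hint (c + 1)).mono' ?_ (.of_forall fun w => ?_)
    · exact (Continuous.aestronglyMeasurable (by fun_prop)).mul
        (aestronglyMeasurable_innerSL_smulRight hk).norm
    · rw [ContinuousLinearMap.norm_smulRight_apply, innerSL_apply_norm, ← mul_assoc,
        Real.norm_of_nonneg (by positivity), add_mul, Real.exp_add, one_mul]
      gcongr
      linarith [Real.add_one_le_exp ‖w‖]

/-! ### Second differences -/

/-- A lower bound on second differences passes to the second derivative. -/
theorem le_fderiv_fderiv_of_second_difference {E : Type*} [NormedAddCommGroup E]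
    [NormedSpace ℝ E] {g : E → ℝ} (hg : ContDiff ℝ 2 g) (x v : E) {c K : ℝ}
    (h : ∀ t : ℝ, c * t ^ 2 * Real.exp (-(K * t ^ 2)) ≤ g (x + t • v) + g (x - t • v) - 2 * g x) :
    c ≤ fderiv ℝ (fderiv ℝ g) x v v := by
  by_contra! hlt
  obtain ⟨b, hb1, hb2⟩ := exists_between hlt
  -- With `b` strictly between the second derivative and `c`, `D''(0) > 0`, so `D` has a local
  -- minimum at `0` and second differences are at most `b t²` nearby. The hypothesis bounds them
  -- below by `c t² exp (-K t²)`, which exceeds `b t²` for small `t ≠ 0`.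
  set D : ℝ → ℝ := fun t => b * t ^ 2 - (g (x + t • v) + g (x - t • v)) with hD
  have hdg : Differentiable ℝ g := hg.differentiable (by norm_num)
  have hdg2 : Differentiable ℝ (fderiv ℝ g) :=
    (hg.fderiv_right (m := 1) (by norm_num)).differentiable (by norm_num)
  have hp : ∀ t : ℝ, HasDerivAt (fun t : ℝ => x + t • v) v t := fun t => by
    simpa using ((hasDerivAt_id t).smul_const v).const_add x
  have hn : ∀ t : ℝ, HasDerivAt (fun t : ℝ => x - t • v) (-v) t := fun t => by
    simpa using ((hasDerivAt_id t).smul_const v).const_sub x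
  have hd1 : deriv D = fun t => b * (2 * t) -
      (fderiv ℝ g (x + t • v) v - fderiv ℝ g (x - t • v) v) := by
    funext t
    have h1 := (hdg (x + t • v)).hasFDerivAt.comp_hasDerivAt t (hp t)
    have h2 := (hdg (x - t • v)).hasFDerivAt.comp_hasDerivAt t (hn t)
    have h3 := ((hasDerivAt_pow 2 t).const_mul b).sub (h1.add h2)
    refine (h3.congr_deriv ?_).deriv
    simp only [map_neg]
    push_cast
    ring
  have hd2 : deriv (deriv D) 0 = 2 * b - 2 * fderiv ℝ (fderiv ℝ g) x v v := by
    rw [hd1]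
    have h1 := (hdg2 (x + (0 : ℝ) • v)).hasFDerivAt.comp_hasDerivAt 0 (hp 0)
    have h2 := (hdg2 (x - (0 : ℝ) • v)).hasFDerivAt.comp_hasDerivAt 0 (hn 0)
    have h1' := h1.clm_apply (hasDerivAt_const (0 : ℝ) v)
    have h2' := h2.clm_apply (hasDerivAt_const (0 : ℝ) v)
    have h3 := (((hasDerivAt_id (0 : ℝ)).const_mul 2).const_mul b).sub (h1'.sub h2')
    refine (h3.congr_deriv ?_).deriv
    simp
    ring
  have hmin : IsLocalMin D 0 := by
    refine isLocalMin_of_deriv_deriv_pos (by rw [hd2]; linarith) (by simp [hd1]) ?_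
    have := hg.continuous
    exact Continuous.continuousAt (by fun_prop)
  have hlim : Filter.Tendsto (fun t : ℝ => c * Real.exp (-(K * t ^ 2))) (nhds 0) (nhds c) := by
    have : Continuous fun t : ℝ => c * Real.exp (-(K * t ^ 2)) := by fun_prop
    simpa using this.tendsto 0
  have hev := (hmin.and (hlim.eventually (lt_mem_nhds hb2))).filter_mono
    (nhdsWithin_le_nhds (s := {0}ᶜ))
  obtain ⟨t, ⟨ht1, ht2⟩, ht3⟩ := (hev.and self_mem_nhdsWithin).exists
  have ht := h t
  simp only [hD, zero_smul, add_zero, sub_zero, ne_eq, OfNat.ofNat_ne_zero, not_false_eq_true,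
    zero_pow, mul_zero] at ht1
  have htp : 0 < t ^ 2 := by
    have : t ≠ 0 := ht3
    positivity
  nlinarith [mul_lt_mul_of_pos_right ht2 htp]

/-! ### Gaussian averages of second differences of absolute values and norms -/

theorem stdGaussian_map_inner {d : ℕ} (u : Vec d) :
    (stdGaussian (Vec d)).map (fun w => inner ℝ u w) = gaussianReal 0 (‖u‖₊ ^ 2) := by
  have h := IsGaussian.map_eq_gaussianReal (μ := stdGaussian (Vec d)) (innerSL ℝ u)
  rwa [integral_strongDual_stdGaussian, variance_dual_stdGaussian, innerSL_apply_norm,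
    Real.toNNReal_pow (norm_nonneg _), norm_toNNReal] at h

theorem integral_abs_gaussianReal :
    ∫ x, |x| ∂(gaussianReal 0 1) = 2 / Real.sqrt (2 * Real.pi) := by
  rw [integral_gaussianReal_eq_integral_smul (by simp)]
  have h1 : ∀ x : ℝ, gaussianPDFReal 0 1 x • |x| =
      (fun y => (Real.sqrt (2 * Real.pi))⁻¹ * (y ^ (1 : ℝ) * Real.exp (-(1 / 2) * y ^ (2 : ℝ)))) |x| := by
    intro x
    simp [gaussianPDFReal]
    ring_nf
  simp_rw [h1]
  rw [integral_comp_abs (f := fun y : ℝ => (Real.sqrt (2 * Real.pi))⁻¹ *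
    (y ^ (1 : ℝ) * Real.exp (-(1 / 2) * y ^ (2 : ℝ)))), integral_const_mul,
    integral_rpow_mul_exp_neg_mul_rpow (by norm_num) (by norm_num) (by norm_num)]
  norm_num [Real.rpow_neg_one]
  ring

theorem integral_abs_inner_stdGaussian {d : ℕ} (u : Vec d) :
    ∫ w, |inner ℝ u w| ∂(stdGaussian (Vec d)) = 2 / Real.sqrt (2 * Real.pi) * ‖u‖ := by
  have h1 : gaussianReal 0 (‖u‖₊ ^ 2) = (gaussianReal 0 1).map (fun x => ‖u‖ * x) := by
    rw [gaussianReal_map_const_mul]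
    congr 1
    · simp
    · ext; simp
  rw [← integral_map (φ := fun w : Vec d => inner ℝ u w) (f := fun x : ℝ => |x|) (by fun_prop)
    (by fun_prop), stdGaussian_map_inner, h1, integral_map (by fun_prop) (by fun_prop)]
  simp_rw [abs_mul, abs_norm]
  rw [integral_const_mul, integral_abs_gaussianReal, mul_comm]

/-! ### Second differences of the absolute value on the line -/

theorem second_difference_abs_nonneg (x r : ℝ) : 0 ≤ |x + r| + |x - r| - 2 * |x| := by
  have := abs_add_le (x + r) (x - r)
  rw [show x + r + (x - r) = 2 * x by ring, abs_mul, abs_two] at this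
  linarith

theorem abs_second_difference_abs_le (x r : ℝ) : |(|x + r| + |x - r| - 2 * |x|)| ≤ 2 * |r| := by
  rw [abs_of_nonneg (second_difference_abs_nonneg x r)]
  have h1 := abs_add_le x r
  have h2 := abs_sub x r
  linarith

theorem second_difference_abs_of_abs_le {x r : ℝ} (h : |x| ≤ |r|) :
    |x + r| + |x - r| - 2 * |x| = 2 * (|r| - |x|) := by
  rcases abs_cases x with ⟨h1, _⟩ | ⟨h1, _⟩ <;> rcases abs_cases r with ⟨h2, _⟩ | ⟨h2, _⟩ <;>
  rcases abs_cases (x + r) with ⟨h3, _⟩ | ⟨h3, _⟩ <;>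
  rcases abs_cases (x - r) with ⟨h4, _⟩ | ⟨h4, _⟩ <;> rw [h3, h4, h1, h2] <;> rw [h1, h2] at h <;>
  linarith

theorem integral_tent_mul_affine (a : ℝ) {R : ℝ} (hR : 0 ≤ R) :
    ∫ y in (-R)..R, (R - |y|) * (1 + y * a) = R ^ 2 := by
  have hc : Continuous fun y : ℝ => (R - |y|) * (1 + y * a) := by fun_prop
  rw [← intervalIntegral.integral_add_adjacent_intervals (b := 0)
    (hc.intervalIntegrable _ _) (hc.intervalIntegrable _ _)]
  have h1 : ∫ y in (-R)..0, (R - |y|) * (1 + y * a) =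
      ∫ y in (-R)..0, (R + y * (1 + R * a) + y ^ 2 * a) := by
    refine intervalIntegral.integral_congr fun y hy => ?_
    rw [Set.uIcc_of_le (by linarith)] at hy
    simp only [abs_of_nonpos hy.2]
    ring
  have h2 : ∫ y in (0)..R, (R - |y|) * (1 + y * a) =
      ∫ y in (0)..R, (R + y * (R * a - 1) + y ^ 2 * (-a)) := by
    refine intervalIntegral.integral_congr fun y hy => ?_
    rw [Set.uIcc_of_le hR] at hy
    simp only [abs_of_nonneg hy.1]
    ring
  rw [h1, h2]
  have h3 : ∀ p q b c e : ℝ, ∫ y in p..q, (b + y * c + y ^ 2 * e) =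
      (q - p) * b + (q ^ 2 - p ^ 2) / 2 * c + (q ^ 3 - p ^ 3) / 3 * e := by
    intro p q b c e
    rw [intervalIntegral.integral_add, intervalIntegral.integral_add,
      intervalIntegral.integral_mul_const, intervalIntegral.integral_mul_const, integral_id,
      integral_pow]
    · simp
      norm_num
    all_goals exact Continuous.intervalIntegrable (by fun_prop) _ _
  rw [h3, h3]
  ring

/-- The Gaussian average of a second difference of the absolute value. -/
theorem le_integral_second_difference_abs_gaussianReal (m r : ℝ) (v : ℝ≥0) :
    2 * r ^ 2 * (Real.sqrt (2 * Real.pi * v))⁻¹ * Real.exp (-(m ^ 2 / (2 * v))) *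
        Real.exp (-(r ^ 2 / (2 * v))) ≤
      ∫ x, (|x + r| + |x - r| - 2 * |x|) ∂(gaussianReal m v) := by
  rcases eq_or_ne v 0 with rfl | hv
  -- For a Dirac mass the left side is `0`, since `(√0)⁻¹ = 0`.
  · simpa using second_difference_abs_nonneg m r
  have hvp : (0 : ℝ) < v := by positivity
  rw [integral_gaussianReal_eq_integral_smul hv]
  set R := |r| with hR
  have hR0 : 0 ≤ R := abs_nonneg r
  set C := (Real.sqrt (2 * Real.pi * v))⁻¹ * Real.exp (-(m ^ 2 / (2 * v))) *
        Real.exp (-(r ^ 2 / (2 * v))) with hC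
  have hC0 : 0 ≤ C := by positivity
  -- The tangent bound `1 + z ≤ exp z` makes the tilt due to the mean affine; its linear part is odd
  -- and vanishes against the even tent `R - |y|`, leaving the area `R²`.
  have hpdf : ∀ y : ℝ, |y| ≤ R → C * (1 + y * (m / v)) ≤ gaussianPDFReal m v y := by
    intro y hy
    have hy2 : y ^ 2 ≤ r ^ 2 := sq_le_sq.2 hy
    have : gaussianPDFReal m v y = (Real.sqrt (2 * Real.pi * v))⁻¹ *
        Real.exp (-(m ^ 2 / (2 * v))) * Real.exp (-(y ^ 2 / (2 * v))) *
          Real.exp (y * (m / v)) := by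
      have he : Real.exp (-(y - m) ^ 2 / (2 * v)) = Real.exp (-(m ^ 2 / (2 * v))) *
          Real.exp (-(y ^ 2 / (2 * v))) * Real.exp (y * (m / v)) := by
        rw [← Real.exp_add, ← Real.exp_add]
        congr 1
        field_simp
        ring
      rw [gaussianPDFReal, he]
      ring
    rw [this]
    calc C * (1 + y * (m / v)) ≤ C * Real.exp (y * (m / v)) := by
          gcongr
          linarith [Real.add_one_le_exp (y * (m / v))]
      _ ≤ _ := by
          rw [hC]
          gcongr
  have hint : Integrable (fun x => gaussianPDFReal m v x • (|x + r| + |x - r| - 2 * |x|)) := by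
    refine ((integrable_gaussianPDFReal m v).mul_const (2 * |r|)).mono'
      (AEStronglyMeasurable.smul (measurable_gaussianPDFReal m v).aestronglyMeasurable
        (Continuous.aestronglyMeasurable (by fun_prop))) (.of_forall fun x => ?_)
    rw [norm_smul, Real.norm_of_nonneg (gaussianPDFReal_nonneg m v x), Real.norm_eq_abs]
    exact mul_le_mul_of_nonneg_left (abs_second_difference_abs_le x r)
      (gaussianPDFReal_nonneg m v x)
  calc 2 * r ^ 2 * (Real.sqrt (2 * Real.pi * v))⁻¹ * Real.exp (-(m ^ 2 / (2 * v))) *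
        Real.exp (-(r ^ 2 / (2 * v))) = 2 * C * R ^ 2 := by
        rw [hC, hR, sq_abs]; ring
    _ = ∫ y in (-R)..R, 2 * C * ((R - |y|) * (1 + y * (m / v))) := by
        rw [intervalIntegral.integral_const_mul, integral_tent_mul_affine _ hR0]
    _ = ∫ y in Set.Ioc (-R) R, 2 * C * ((R - |y|) * (1 + y * (m / v))) :=
        intervalIntegral.integral_of_le (by linarith)
    _ ≤ ∫ y in Set.Ioc (-R) R, gaussianPDFReal m v y • (|y + r| + |y - r| - 2 * |y|) := by
        refine setIntegral_mono_on ?_ hint.integrableOn measurableSet_Ioc fun y hy => ?_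
        · exact (Continuous.integrableOn_Icc (by fun_prop)).mono_set Set.Ioc_subset_Icc_self
        have hy' : |y| ≤ R := abs_le.2 ⟨hy.1.le, hy.2⟩
        rw [second_difference_abs_of_abs_le hy', smul_eq_mul]
        have := mul_le_mul_of_nonneg_left (hpdf y hy') (sub_nonneg.2 hy')
        rw [← hR]
        linarith
    _ ≤ _ := by
        refine setIntegral_le_integral hint (.of_forall fun y => ?_)
        exact mul_nonneg (gaussianPDFReal_nonneg m v y) (second_difference_abs_nonneg y r)

/-! ### Moments of the norm under the standard Gaussian -/

theorem integrable_norm_stdGaussian {d : ℕ} :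
    Integrable (fun w : Vec d => ‖w‖) (stdGaussian (Vec d)) :=
  (IsGaussian.integrable_id (μ := stdGaussian (Vec d))).norm

theorem integrable_norm_sq_stdGaussian {d : ℕ} :
    Integrable (fun w : Vec d => ‖w‖ ^ 2) (stdGaussian (Vec d)) :=
  (IsGaussian.memLp_two_id (μ := stdGaussian (Vec d))).integrable_norm_pow (by norm_num)

theorem integral_norm_sq_stdGaussian {d : ℕ} :
    ∫ w, ‖w‖ ^ 2 ∂(stdGaussian (Vec d)) = d := by
  have h1 : ∀ i : Fin d, ∫ w : Vec d, (w i) ^ 2 ∂(stdGaussian (Vec d)) = 1 := by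
    intro i
    have h := variance_dual_stdGaussian (innerSL ℝ (EuclideanSpace.single i (1 : ℝ) : Vec d))
    rw [variance_of_integral_eq_zero (by fun_prop) (integral_strongDual_stdGaussian _)] at h
    have h2 : ∀ w : Vec d, innerSL ℝ (EuclideanSpace.single i (1 : ℝ) : Vec d) w = w i := by
      intro w
      simp [EuclideanSpace.inner_single_left]
    simp_rw [h2] at h
    rw [h]
    simp
  simp_rw [EuclideanSpace.real_norm_sq_eq]
  rw [integral_finsetSum]
  · simp [h1]
  · intro i _
    refine integrable_norm_sq_stdGaussian.mono' (Measurable.aestronglyMeasurable (by fun_prop))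
      (.of_forall fun w => ?_)
    rw [Real.norm_of_nonneg (sq_nonneg _), EuclideanSpace.real_norm_sq_eq]
    exact Finset.single_le_sum (f := fun j => w j ^ 2) (fun j _ => sq_nonneg _) (Finset.mem_univ i)

/-- Average `‖w‖ ≤ ‖w‖² / (2√d) + √d / 2`. -/
theorem integral_norm_stdGaussian_le {d : ℕ} :
    ∫ w, ‖w‖ ∂(stdGaussian (Vec d)) ≤ Real.sqrt d := by
  rcases Nat.eq_zero_or_pos d with rfl | hd
  · have : ∀ w : Vec 0, ‖w‖ = 0 := fun w => by rw [Subsingleton.elim w 0, norm_zero]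
    simp [this]
  have hs : 0 < Real.sqrt d := Real.sqrt_pos.2 (by exact_mod_cast hd)
  calc ∫ w, ‖w‖ ∂(stdGaussian (Vec d))
      ≤ ∫ w, ((2 * Real.sqrt d)⁻¹ * ‖w‖ ^ 2 + Real.sqrt d / 2) ∂(stdGaussian (Vec d)) := by
        refine integral_mono integrable_norm_stdGaussian
          ((integrable_norm_sq_stdGaussian.const_mul _).add (integrable_const _)) fun w => ?_
        have : (2 * Real.sqrt d)⁻¹ * ‖w‖ ^ 2 + Real.sqrt d / 2 - ‖w‖ =
            (‖w‖ - Real.sqrt d) ^ 2 / (2 * Real.sqrt d) := by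
          field_simp
          ring
        have h2 : 0 ≤ (‖w‖ - Real.sqrt d) ^ 2 / (2 * Real.sqrt d) := by positivity
        simp only
        linarith
    _ = Real.sqrt d := by
        rw [integral_add (integrable_norm_sq_stdGaussian.const_mul _) (integrable_const _),
          integral_const_mul, integral_norm_sq_stdGaussian]
        have h3 : (2 * Real.sqrt d)⁻¹ * (d : ℝ) = Real.sqrt d / 2 := by
          nth_rewrite 2 [← Real.mul_self_sqrt (Nat.cast_nonneg d)]
          field_simp
        rw [h3]
        simp

/-! ### Second differences of the norm -/

theorem second_difference_norm_nonneg {E : Type*} [SeminormedAddCommGroup E] [NormedSpace ℝ E]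
    (z v : E) : 0 ≤ ‖z + v‖ + ‖z - v‖ - 2 * ‖z‖ := by
  have := norm_add_le (z + v) (z - v)
  rw [show z + v + (z - v) = (2 : ℝ) • z by module, norm_smul] at this
  norm_num at this
  linarith

theorem integrable_abs_inner_stdGaussian {d : ℕ} (u : Vec d) :
    Integrable (fun g : Vec d => |inner ℝ u g|) (stdGaussian (Vec d)) :=
  (integrable_norm_stdGaussian.const_mul ‖u‖).mono' (Continuous.aestronglyMeasurable (by fun_prop))
    (.of_forall fun g => by simpa using abs_real_inner_le_norm u g)

/-- The norm is an average of absolute values of linear functionals. -/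
theorem integral_second_difference_abs_inner {d : ℕ} (z v : Vec d) :
    ∫ g, (|inner ℝ z g + inner ℝ v g| + |inner ℝ z g - inner ℝ v g| - 2 * |inner ℝ z g|)
      ∂(stdGaussian (Vec d)) =
      2 / Real.sqrt (2 * Real.pi) * (‖z + v‖ + ‖z - v‖ - 2 * ‖z‖) := by
  simp_rw [← inner_add_left, ← inner_sub_left]
  rw [integral_sub, integral_add, integral_const_mul]
  · simp_rw [integral_abs_inner_stdGaussian]
    ring
  · exact integrable_abs_inner_stdGaussian _
  · exact integrable_abs_inner_stdGaussian _
  · exact (integrable_abs_inner_stdGaussian _).add (integrable_abs_inner_stdGaussian _)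
  · exact (integrable_abs_inner_stdGaussian _).const_mul 2

/-- With `u = A* g`, `⟨a + A w, g⟩` is Gaussian with mean `⟨a, g⟩` and variance `‖u‖²`. As `B` is a
right inverse of `A`, `⟨x, g⟩ = ⟨B x, u⟩`, and Cauchy–Schwarz makes both exponential factors
independent of `g`; `hA` gives `1/‖u‖ ≥ √p/‖g‖`. -/
theorem le_integral_second_difference_abs_inner {d : ℕ} (A B : Vec d →L[ℝ] Vec d)
    (hAB : ∀ x, A (B x) = x) (a v g : Vec d) {p : ℝ} (hp : 0 < p)
    (hA : ∀ g, p * ‖A.adjoint g‖ ^ 2 ≤ ‖g‖ ^ 2) :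
    2 / Real.sqrt (2 * Real.pi) * Real.sqrt p * Real.exp (-(‖B a‖ ^ 2 / 2)) *
        Real.exp (-(‖B v‖ ^ 2 / 2)) * (inner ℝ v g ^ 2 / ‖g‖) ≤
      ∫ w, (|inner ℝ (a + A w) g + inner ℝ v g| + |inner ℝ (a + A w) g - inner ℝ v g|
        - 2 * |inner ℝ (a + A w) g|) ∂(stdGaussian (Vec d)) := by
  set u := A.adjoint g with hu
  have hin : ∀ x, inner ℝ x g = inner ℝ (B x) u := by
    intro x
    rw [hu, ContinuousLinearMap.adjoint_inner_right, hAB]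
  rcases eq_or_ne u 0 with h0 | h0
  · rw [hin v, h0]
    simp only [inner_zero_right, ne_eq, OfNat.ofNat_ne_zero, not_false_eq_true, zero_pow, zero_div,
      mul_zero]
    refine integral_nonneg fun w => ?_
    exact second_difference_abs_nonneg _ _
  have hu0 : 0 < ‖u‖ := norm_pos_iff.2 h0
  have hlaw : (stdGaussian (Vec d)).map (fun w => inner ℝ (a + A w) g) =
      gaussianReal (inner ℝ a g) (‖u‖₊ ^ 2) := by
    have : (fun w => inner ℝ (a + A w) g) = (fun x => inner ℝ a g + x) ∘ fun w => inner ℝ u w := by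
      funext w
      simp [inner_add_left, hu, ContinuousLinearMap.adjoint_inner_left, real_inner_comm]
    rw [this, ← Measure.map_map (by fun_prop) (by fun_prop), stdGaussian_map_inner,
      gaussianReal_map_const_add, zero_add]
  rw [← integral_map (φ := fun w => inner ℝ (a + A w) g)
    (f := fun x => |x + inner ℝ v g| + |x - inner ℝ v g| - 2 * |x|) (by fun_prop)
    (Continuous.aestronglyMeasurable (by fun_prop)), hlaw]
  refine le_trans ?_ (le_integral_second_difference_abs_gaussianReal _ _ _)
  have hcs : ∀ x, inner ℝ x g ^ 2 / (2 * ‖u‖ ^ 2) ≤ ‖B x‖ ^ 2 / 2 := by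
    intro x
    rw [hin, div_le_div_iff₀ (by positivity) (by norm_num)]
    have := sq_le_sq.2 ((abs_real_inner_le_norm (B x) u).trans (le_abs_self _))
    rw [mul_pow] at this
    linarith
  have hs : Real.sqrt (2 * Real.pi * ‖u‖ ^ 2) = Real.sqrt (2 * Real.pi) * ‖u‖ := by
    rw [Real.sqrt_mul (by positivity), Real.sqrt_sq (norm_nonneg u)]
  have hpg : Real.sqrt p * ‖u‖ ≤ ‖g‖ := by
    rw [← Real.sqrt_sq (norm_nonneg g), ← Real.sqrt_sq (norm_nonneg u), ← Real.sqrt_mul hp.le]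
    exact Real.sqrt_le_sqrt (hA g)
  have hpi : 0 < Real.sqrt (2 * Real.pi) := by positivity
  have hsp : 0 < Real.sqrt p := by positivity
  have hg0 : 0 < ‖g‖ := lt_of_lt_of_le (by positivity) hpg
  simp only [NNReal.coe_pow, coe_nnnorm, hs]
  calc 2 / Real.sqrt (2 * Real.pi) * Real.sqrt p * Real.exp (-(‖B a‖ ^ 2 / 2)) *
        Real.exp (-(‖B v‖ ^ 2 / 2)) * (inner ℝ v g ^ 2 / ‖g‖) =
      2 * inner ℝ v g ^ 2 * ((Real.sqrt (2 * Real.pi))⁻¹ * (Real.sqrt p / ‖g‖)) *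
        Real.exp (-(‖B a‖ ^ 2 / 2)) * Real.exp (-(‖B v‖ ^ 2 / 2)) := by ring
    _ ≤ _ := by
      rw [mul_inv]
      have hq : Real.sqrt p / ‖g‖ ≤ ‖u‖⁻¹ := by
        rw [div_le_iff₀ hg0, inv_mul_eq_div, le_div_iff₀ hu0]
        exact hpg
      exact mul_le_mul (mul_le_mul (by gcongr) (Real.exp_le_exp.2 (neg_le_neg (hcs a)))
        (by positivity) (by positivity)) (Real.exp_le_exp.2 (neg_le_neg (hcs v)))
        (by positivity) (by positivity)

/-- The Gaussian average of a second difference of the norm. -/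
theorem le_integral_second_difference_norm {d : ℕ} (A B : Vec d →L[ℝ] Vec d)
    (hAB : ∀ x, A (B x) = x) (a v : Vec d) {p : ℝ} (hp : 0 < p)
    (hA : ∀ g, p * ‖A.adjoint g‖ ^ 2 ≤ ‖g‖ ^ 2) :
    2 / Real.pi / Real.sqrt d * Real.sqrt p * Real.exp (-(‖B a‖ ^ 2 / 2)) *
        Real.exp (-(‖B v‖ ^ 2 / 2)) * ‖v‖ ^ 2 ≤
      ∫ w, (‖a + A w + v‖ + ‖a + A w - v‖ - 2 * ‖a + A w‖) ∂(stdGaussian (Vec d)) := by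
  rcases Nat.eq_zero_or_pos d with rfl | hd
  · simp only [CharP.cast_eq_zero, Real.sqrt_zero, div_zero, zero_mul]
    exact integral_nonneg fun w => second_difference_norm_nonneg _ _
  have hsd : 0 < Real.sqrt d := Real.sqrt_pos.2 (by exact_mod_cast hd)
  set γ := stdGaussian (Vec d) with hγ
  set c₀ := 2 / Real.sqrt (2 * Real.pi) with hc₀
  have hc₀p : 0 < c₀ := by positivity
  have hc₀2 : c₀ ^ 2 = 2 / Real.pi := by
    rw [hc₀, div_pow, Real.sq_sqrt (by positivity)]
    field_simp
  set K := Real.sqrt p * Real.exp (-(‖B a‖ ^ 2 / 2)) * Real.exp (-(‖B v‖ ^ 2 / 2)) with hK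
  have hK0 : 0 ≤ K := by positivity
  set D : Vec d → Vec d → ℝ := fun w g => |inner ℝ (a + A w) g + inner ℝ v g| +
    |inner ℝ (a + A w) g - inner ℝ v g| - 2 * |inner ℝ (a + A w) g| with hD
  -- Fubini applies because the second difference is at most `2 |⟨v, g⟩|`, uniformly in `w`.
  have hDi : Integrable (Function.uncurry D) (γ.prod γ) := by
    have h1 : Integrable (fun q : Vec d × Vec d => 2 * |inner ℝ v q.2|) (γ.prod γ) :=
      ((integrable_abs_inner_stdGaussian v).comp_snd γ).const_mul 2
    refine h1.mono' (Continuous.aestronglyMeasurable ?_) (.of_forall fun q =>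
      abs_second_difference_abs_le _ _)
    simp only [hD, Function.uncurry_def]
    fun_prop
  have h2 : c₀ * ∫ w, (‖a + A w + v‖ + ‖a + A w - v‖ - 2 * ‖a + A w‖) ∂γ =
      ∫ g, ∫ w, D w g ∂γ ∂γ := by
    rw [← integral_integral_swap hDi, ← integral_const_mul]
    exact integral_congr_ae (.of_forall fun w =>
      (integral_second_difference_abs_inner (a + A w) v).symm)
  -- The mean of `⟨v, g⟩² / ‖g‖` is bounded below through `2 e |⟨v, g⟩| - e² ‖g‖`, valid for every
  -- `e`. This `e` is optimal given `E|⟨v, g⟩| = c₀ ‖v‖` and `E‖g‖ ≤ √d`.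
  set e := c₀ * ‖v‖ / Real.sqrt d with he
  have h3 : c₀ * K * (2 * e * (c₀ * ‖v‖) - e ^ 2 * Real.sqrt d) ≤ ∫ g, ∫ w, D w g ∂γ ∂γ := by
    calc c₀ * K * (2 * e * (c₀ * ‖v‖) - e ^ 2 * Real.sqrt d)
        ≤ c₀ * K * (2 * e * (c₀ * ‖v‖) - e ^ 2 * ∫ g, ‖g‖ ∂γ) := by
          gcongr
          exact integral_norm_stdGaussian_le
      _ = ∫ g, c₀ * K * (2 * e * |inner ℝ v g| - e ^ 2 * ‖g‖) ∂γ := by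
          rw [integral_const_mul, integral_sub ((integrable_abs_inner_stdGaussian v).const_mul _)
            (integrable_norm_stdGaussian.const_mul _), integral_const_mul, integral_const_mul,
            integral_abs_inner_stdGaussian]
      _ ≤ _ := by
          refine integral_mono ((((integrable_abs_inner_stdGaussian v).const_mul _).sub
            (integrable_norm_stdGaussian.const_mul _)).const_mul _) hDi.integral_prod_right
            fun g => ?_
          refine le_trans ?_ (le_integral_second_difference_abs_inner A B hAB a v g hp hA)
          have h4 : 2 * e * |inner ℝ v g| - e ^ 2 * ‖g‖ ≤ inner ℝ v g ^ 2 / ‖g‖ := by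
            rcases eq_or_ne g 0 with rfl | hg
            · simp
            rw [le_div_iff₀ (norm_pos_iff.2 hg)]
            nlinarith [sq_nonneg (|inner ℝ v g| - e * ‖g‖), sq_abs (inner ℝ v g)]
          calc c₀ * K * (2 * e * |inner ℝ v g| - e ^ 2 * ‖g‖) ≤
              c₀ * K * (inner ℝ v g ^ 2 / ‖g‖) := by gcongr
            _ = _ := by rw [hK, hc₀]; ring
  rw [← h2] at h3
  have h5 : c₀ * K * (2 * e * (c₀ * ‖v‖) - e ^ 2 * Real.sqrt d) =
      c₀ * (2 / Real.pi / Real.sqrt d * K * ‖v‖ ^ 2) := by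
    rw [← hc₀2, he]
    field_simp
    ring
  rw [h5] at h3
  refine le_trans (le_of_eq ?_) (le_of_mul_le_mul_left h3 hc₀p)
  rw [hK]
  ring

/-! ### Quadratic forms of matrices -/

theorem normSqWrt_hessianMat {d : ℕ} (g : Vec d → ℝ) (x v : Vec d) :
    normSqWrt (hessianMat g x) v = fderiv ℝ (fderiv ℝ g) x v v := by
  have hv : v = ∑ i, v i • (EuclideanSpace.single i (1 : ℝ) : Vec d) := by
    have := (EuclideanSpace.basisFun (Fin d) ℝ).sum_repr v
    simpa using this.symm
  conv_rhs => rw [hv]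
  simp only [map_sum, map_smul, _root_.sum_apply, _root_.smul_apply,
    smul_eq_mul, normSqWrt, dotProduct, Matrix.mulVec, hessianMat, Matrix.of_apply]
  simp only [Finset.mul_sum]
  rw [Finset.sum_comm]
  refine Finset.sum_congr rfl fun i _ => Finset.sum_congr rfl fun j _ => ?_
  ring

theorem normSqWrt_one {d : ℕ} (v : Vec d) : normSqWrt (1 : Mat d) v = ‖v‖ ^ 2 := by
  rw [normSqWrt, Matrix.one_mulVec, EuclideanSpace.real_norm_sq_eq, dotProduct]
  exact Finset.sum_congr rfl fun i _ => by ring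

theorem normSqWrt_add {d : ℕ} (A B : Mat d) (v : Vec d) :
    normSqWrt (A + B) v = normSqWrt A v + normSqWrt B v := by
  simp [normSqWrt, Matrix.add_mulVec]

theorem normSqWrt_sub {d : ℕ} (A B : Mat d) (v : Vec d) :
    normSqWrt (A - B) v = normSqWrt A v - normSqWrt B v := by
  simp [normSqWrt, Matrix.sub_mulVec]

theorem normSqWrt_smul {d : ℕ} (c : ℝ) (A : Mat d) (v : Vec d) :
    normSqWrt (c • A) v = c * normSqWrt A v := by
  simp [normSqWrt, Matrix.smul_mulVec]

theorem normSqWrt_sum {d : ℕ} {ι : Type*} (s : Finset ι) (A : ι → Mat d) (v : Vec d) :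
    normSqWrt (∑ i ∈ s, A i) v = ∑ i ∈ s, normSqWrt (A i) v := by
  simp [normSqWrt, Matrix.sum_mulVec, dotProduct_sum]

theorem Matrix.PosSemidef.normSqWrt_nonneg {d : ℕ} {A : Mat d} (hA : A.PosSemidef) (v : Vec d) :
    0 ≤ normSqWrt A v := by
  simpa [normSqWrt] using hA.dotProduct_mulVec_nonneg v.ofLp

theorem LoewnerLE.normSqWrt_le {d : ℕ} {A B : Mat d} (h : LoewnerLE A B) (v : Vec d) :
    normSqWrt A v ≤ normSqWrt B v := by
  have := Matrix.PosSemidef.normSqWrt_nonneg h v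
  rw [normSqWrt_sub] at this
  linarith

theorem loewnerLE_smul_one_of_forall {d : ℕ} {A : Mat d} (hA : A.IsHermitian) {c : ℝ}
    (h : ∀ v : Vec d, c * ‖v‖ ^ 2 ≤ normSqWrt A v) : LoewnerLE (c • (1 : Mat d)) A := by
  refine Matrix.PosSemidef.of_dotProduct_mulVec_nonneg
    (hA.sub (Matrix.isHermitian_one.smul (IsSelfAdjoint.all c))) fun x => ?_
  have h1 := h (WithLp.toLp 2 x)
  have h2 := normSqWrt_sub A (c • (1 : Mat d)) (WithLp.toLp 2 x)
  rw [normSqWrt_smul, normSqWrt_one] at h2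
  have h3 : 0 ≤ normSqWrt (A - c • (1 : Mat d)) (WithLp.toLp 2 x) := by linarith
  simpa [normSqWrt] using h3

theorem norm_sq_toEuclideanCLM {d : ℕ} (M : Mat d) (v : Vec d) :
    ‖Matrix.toEuclideanCLM (𝕜 := ℝ) M v‖ ^ 2 = normSqWrt (M.transpose * M) v := by
  rw [EuclideanSpace.real_norm_sq_eq, normSqWrt, ← Matrix.mulVec_mulVec, Matrix.dotProduct_mulVec,
    Matrix.vecMul_transpose]
  simp [dotProduct, sq]

/-- For `y = P⁻¹ g`, `p ‖y‖² ≤ ⟨y, g⟩ ≤ ‖y‖ ‖g‖`, hence `p ‖y‖ ≤ ‖g‖`. -/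
theorem mul_normSqWrt_inv_le {d : ℕ} {P : Mat d} (hP : P.PosDef) {p : ℝ} (hp : 0 ≤ p)
    (h : ∀ v : Vec d, p * ‖v‖ ^ 2 ≤ normSqWrt P v) (g : Vec d) :
    p * normSqWrt P⁻¹ g ≤ ‖g‖ ^ 2 := by
  set y : Vec d := mulV P⁻¹ g with hy
  have h1 : normSqWrt P⁻¹ g = inner ℝ y g := by
    simp [normSqWrt, hy, mulV, EuclideanSpace.inner_eq_star_dotProduct]
  have h2 : normSqWrt P y = inner ℝ y g := by
    have : P.mulVec y.ofLp = g.ofLp := by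
      rw [hy, mulV, Matrix.mulVec_mulVec, Matrix.mul_nonsing_inv _ hP.det_pos.ne'.isUnit,
        Matrix.one_mulVec]
    rw [normSqWrt, this, dotProduct_comm]
    simp [EuclideanSpace.inner_eq_star_dotProduct]
  have h3 := h y
  rw [h2] at h3
  have h4 := real_inner_le_norm y g
  rw [h1]
  have h5 : p * ‖y‖ ≤ ‖g‖ := by
    rcases eq_or_lt_of_le (norm_nonneg y) with h0 | h0
    · rw [← h0]; simp
    · nlinarith
  nlinarith [norm_nonneg g, mul_le_mul_of_nonneg_right h5 (norm_nonneg g)]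

/-! ### The Hessian of the surrogate -/

theorem IsAdmissibleLoss.continuous {d : ℕ} {β G : ℝ} {f : Vec d → ℝ} {xs : Vec d}
    (hf : IsAdmissibleLoss β G f xs) : Continuous f := by
  refine (LipschitzWith.of_dist_le_mul (K := G.toNNReal) fun x y => ?_).continuous
  rw [Real.dist_eq, dist_eq_norm]
  exact (hf.lipschitz x y).trans (by gcongr; exact Real.le_coe_toNNReal G)

theorem IsAdmissibleLoss.abs_affine_le {d : ℕ} {β G : ℝ} {f : Vec d → ℝ} {xs : Vec d}
    (hf : IsAdmissibleLoss β G f xs) (b : Vec d) (A : Vec d →L[ℝ] Vec d) (w : Vec d) :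
    |f (b + A w)| ≤ (|f b| + |G| * ‖A‖) * Real.exp ‖w‖ := by
  have h1 := hf.lipschitz (b + A w) b
  rw [add_sub_cancel_left] at h1
  have h2 : G * ‖A w‖ ≤ |G| * ‖A‖ * ‖w‖ := by
    rw [mul_assoc]
    exact mul_le_mul (le_abs_self G) (A.le_opNorm w) (norm_nonneg _) (abs_nonneg G)
  have h3 : |f (b + A w)| ≤ |f b| + |G| * ‖A‖ * ‖w‖ := by
    have := abs_sub_abs_le_abs_sub (f (b + A w)) (f b)
    linarith
  have h4 : (1 : ℝ) ≤ Real.exp ‖w‖ := Real.one_le_exp (norm_nonneg w)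
  have h5 : ‖w‖ ≤ Real.exp ‖w‖ := by linarith [Real.add_one_le_exp ‖w‖]
  calc |f (b + A w)| ≤ |f b| * 1 + |G| * ‖A‖ * ‖w‖ := by linarith
    _ ≤ |f b| * Real.exp ‖w‖ + |G| * ‖A‖ * Real.exp ‖w‖ := by gcongr
    _ = _ := by ring

theorem IsAdmissibleLoss.integrable_exp_mul_affine {d : ℕ} {β G : ℝ} {f : Vec d → ℝ} {xs : Vec d}
    (hf : IsAdmissibleLoss β G f xs) (b : Vec d) (A : Vec d →L[ℝ] Vec d) (c : ℝ) :
    Integrable (fun w => Real.exp (c * ‖w‖) * ‖f (b + A w)‖) (stdGaussian (Vec d)) := by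
  have hc := hf.continuous
  refine ((integrable_exp_mul_norm_stdGaussian (c + 1)).const_mul (|f b| + |G| * ‖A‖)).mono'
    (Continuous.aestronglyMeasurable (by fun_prop)) (.of_forall fun w => ?_)
  rw [Real.norm_of_nonneg (by positivity), Real.norm_eq_abs]
  calc Real.exp (c * ‖w‖) * |f (b + A w)| ≤
      Real.exp (c * ‖w‖) * ((|f b| + |G| * ‖A‖) * Real.exp ‖w‖) := by
        gcongr
        exact hf.abs_affine_le b A w
    _ = _ := by rw [show (c + 1) * ‖w‖ = c * ‖w‖ + ‖w‖ by ring, Real.exp_add]; ring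

theorem IsAdmissibleLoss.integrable_affine {d : ℕ} {β G : ℝ} {f : Vec d → ℝ} {xs : Vec d}
    (hf : IsAdmissibleLoss β G f xs) (b : Vec d) (A : Vec d →L[ℝ] Vec d) :
    Integrable (fun w => f (b + A w)) (stdGaussian (Vec d)) := by
  have hc := hf.continuous
  have h := hf.integrable_exp_mul_affine b A 0
  simp only [zero_mul, Real.exp_zero, one_mul] at h
  exact (integrable_norm_iff (Continuous.aestronglyMeasurable (by fun_prop))).1 h

/-- Gaussian smoothing of an admissible loss is smooth. -/
theorem IsAdmissibleLoss.contDiff_integral {d : ℕ} {β G : ℝ} {f : Vec d → ℝ} {xs : Vec d}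
    (hf : IsAdmissibleLoss β G f xs) (A B : Vec d →L[ℝ] Vec d) (hAB : ∀ x, A (B x) = x)
    (b : Vec d) (n : ℕ) :
    ContDiff ℝ n (fun y => ∫ w, f (b + y + A w) ∂(stdGaussian (Vec d))) := by
  have hc := hf.continuous
  -- By Cameron–Martin with shift `B y`, the variable `y` leaves the Lipschitz function `f` and
  -- enters only through exponentials.
  have h1 : ∀ y, ∫ w, f (b + y + A w) ∂(stdGaussian (Vec d)) =
      Real.exp (-(‖B y‖ ^ 2 / 2)) *
        ∫ w, Real.exp (inner ℝ (B y) w) • f (b + A w) ∂(stdGaussian (Vec d)) := by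
    intro y
    have := integral_add_left_stdGaussian (B y) (k := fun w => f (b + A w)) (by fun_prop)
    simp only [map_add, hAB, ← add_assoc] at this
    exact this
  simp_rw [h1]
  have h2 := contDiff_integral_exp_inner n (stdGaussian (Vec d)) (k := fun w => f (b + A w))
    (Continuous.aestronglyMeasurable (by fun_prop)) (hf.integrable_exp_mul_affine b A)
  refine ContDiff.mul ?_ (h2.comp B.contDiff)
  exact (((B.contDiff.norm_sq ℝ).div_const 2).neg).exp

theorem IsAdmissibleLoss.second_difference_le {d : ℕ} {β G : ℝ} {f : Vec d → ℝ} {xs : Vec d}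
    (hf : IsAdmissibleLoss β G f xs) (z v : Vec d) :
    β * (‖z - xs + v‖ + ‖z - xs - v‖ - 2 * ‖z - xs‖) ≤ f (z + v) + f (z - v) - 2 * f z := by
  obtain ⟨_, _, _, hc⟩ := hf.convex
  have h := hc (Set.mem_univ (z + v)) (Set.mem_univ (z - v))
    (show (0 : ℝ) ≤ 1 / 2 by norm_num) (show (0 : ℝ) ≤ 1 / 2 by norm_num) (by norm_num)
  rw [show (1 / 2 : ℝ) • (z + v) + (1 / 2 : ℝ) • (z - v) = z by module] at h
  simp only [Real.rpow_one, smul_eq_mul] at h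
  rw [show z - xs + v = z + v - xs by abel, show z - xs - v = z - v - xs by abel]
  linarith

/-- Writing `X = m + √S w` with `w` standard Gaussian isolates a term constant in `x`; only the
second one carries curvature. -/
theorem surrogate_eq {d : ℕ} {β G : ℝ} {f : Vec d → ℝ} {xs : Vec d}
    (hf : IsAdmissibleLoss β G f xs) (lam : ℝ) (m : Vec d) (S : Mat d) (x : Vec d) :
    surrogate f lam m S x =
      (1 - 1 / lam) * ∫ w, f (m + Matrix.toEuclideanCLM (𝕜 := ℝ) (CFC.sqrt S) w)
        ∂(stdGaussian (Vec d)) +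
      (1 / lam) * ∫ w, f ((1 - lam) • m + lam • x +
        ((1 - lam) • Matrix.toEuclideanCLM (𝕜 := ℝ) (CFC.sqrt S)) w) ∂(stdGaussian (Vec d)) := by
  have hc := hf.continuous
  rw [surrogate, multivariateGaussian, integral_map (by fun_prop)
    (Continuous.aestronglyMeasurable (by fun_prop)), ← integral_const_mul, ← integral_const_mul,
    ← integral_add ((hf.integrable_affine _ _).const_mul _)
      ((hf.integrable_affine _ _).const_mul _)]
  refine integral_congr_ae (.of_forall fun w => ?_)
  simp only [_root_.smul_apply, smul_add]
  congr 3
  abel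

/-- The smoothing map is `A = (1 - lam) P^(-1/2)`, with right inverse `B` satisfying `‖B x‖² =
‖x‖²_P / (1 - lam)²`. A step `t v` in `x` moves the argument of `f` by `lam t v`, so the factor
`lam` is `(1/lam) lam²`. -/
theorem le_normSqWrt_hessianMat_surrogate {d : ℕ} {β G : ℝ} {f : Vec d → ℝ} {xs : Vec d}
    (hf : IsAdmissibleLoss β G f xs) {lam : ℝ} (hlam0 : 0 < lam) (hlam1 : lam < 1)
    {P : Mat d} (hP : P.PosDef) {p : ℝ} (hp : 0 < p)
    (hpP : ∀ v : Vec d, p * ‖v‖ ^ 2 ≤ normSqWrt P v) (m v : Vec d) :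
    β * lam * (2 / Real.pi / Real.sqrt d) * Real.sqrt p *
        Real.exp (-(normSqWrt P (m - xs) / (2 * (1 - lam) ^ 2))) * ‖v‖ ^ 2 ≤
      normSqWrt (hessianMat (surrogate f lam m P⁻¹) m) v := by
  have hl : 0 < 1 - lam := by linarith
  have hβ : 0 < β := hf.convex.1
  set R := CFC.sqrt P⁻¹ with hR
  have hRR : R * R = P⁻¹ := CFC.sqrt_mul_sqrt_self _ hP.inv.posSemidef.nonneg
  have hRs : R.transpose = R := by
    have : IsSelfAdjoint R := (CFC.sqrt_nonneg P⁻¹).isSelfAdjoint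
    simpa [IsSelfAdjoint, Matrix.star_eq_conjTranspose] using this
  have hPs : P.transpose = P := by simpa [Matrix.IsHermitian] using hP.1
  have hdet : IsUnit P.det := hP.det_pos.ne'.isUnit
  set A : Vec d →L[ℝ] Vec d := (1 - lam) • Matrix.toEuclideanCLM (𝕜 := ℝ) R with hA
  set B : Vec d →L[ℝ] Vec d := (1 - lam)⁻¹ • Matrix.toEuclideanCLM (𝕜 := ℝ) (R * P) with hB
  have hAB : ∀ x, A (B x) = x := by
    intro x
    have h1 : Matrix.toEuclideanCLM (𝕜 := ℝ) R (Matrix.toEuclideanCLM (𝕜 := ℝ) (R * P) x) = x := by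
      rw [← mul_apply_eq_comp, ← map_mul, ← mul_assoc, hRR,
        Matrix.nonsing_inv_mul _ hdet, map_one, one_apply_eq_self]
    rw [hA, hB, _root_.smul_apply, _root_.smul_apply, map_smul, h1,
      smul_smul, mul_inv_cancel₀ hl.ne', one_smul]
  have hBn : ∀ x, ‖B x‖ ^ 2 = normSqWrt P x / (1 - lam) ^ 2 := by
    intro x
    rw [hB, _root_.smul_apply, norm_smul, mul_pow, norm_sq_toEuclideanCLM,
      Matrix.transpose_mul, hRs, hPs, mul_assoc, ← mul_assoc R, hRR,
      Matrix.nonsing_inv_mul _ hdet, mul_one, norm_inv, Real.norm_of_nonneg hl.le]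
    field_simp
  have hAn : ∀ g, p * ‖A.adjoint g‖ ^ 2 ≤ ‖g‖ ^ 2 := by
    intro g
    have h1 : A.adjoint = A := by
      have : IsSelfAdjoint (Matrix.toEuclideanCLM (𝕜 := ℝ) R) :=
        (CFC.sqrt_nonneg P⁻¹).isSelfAdjoint.map _
      have h2 : IsSelfAdjoint A := (IsSelfAdjoint.all (1 - lam)).smul this
      exact h2
    rw [h1, hA, _root_.smul_apply, norm_smul, mul_pow, norm_sq_toEuclideanCLM, hRs,
      hRR, Real.norm_of_nonneg hl.le]
    have h3 := mul_normSqWrt_inv_le hP hp.le hpP g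
    have h4 := hP.inv.posSemidef.normSqWrt_nonneg g
    have h5 : (1 - lam) ^ 2 ≤ 1 := by nlinarith
    nlinarith [mul_le_mul_of_nonneg_right h5 (mul_nonneg hp.le h4)]
  have hs : surrogate f lam m P⁻¹ = fun x =>
      (1 - 1 / lam) * ∫ w, f (m + Matrix.toEuclideanCLM (𝕜 := ℝ) R w) ∂(stdGaussian (Vec d)) +
      (1 / lam) * ∫ w, f ((1 - lam) • m + lam • x + A w) ∂(stdGaussian (Vec d)) :=
    funext fun x => surrogate_eq hf lam m P⁻¹ x
  have hsmooth : ContDiff ℝ 2 (surrogate f lam m P⁻¹) := by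
    rw [hs]
    have h1 := (hf.contDiff_integral A B hAB ((1 - lam) • m) 2).comp
      (contDiff_const_smul lam (F := Vec d))
    exact contDiff_const.add (contDiff_const.mul h1)
  rw [normSqWrt_hessianMat]
  refine le_fderiv_fderiv_of_second_difference hsmooth m v
    (K := lam ^ 2 * ‖B v‖ ^ 2 / 2) fun t => ?_
  have hi : ∀ y, Integrable (fun w => f (y + A w)) (stdGaussian (Vec d)) := fun y =>
    hf.integrable_affine y A
  have e1 : (1 - lam) • m + lam • (m + t • v) = m + (lam * t) • v := by module
  have e2 : (1 - lam) • m + lam • (m - t • v) = m - (lam * t) • v := by module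
  have e3 : (1 - lam) • m + lam • m = m := by module
  rw [hs]
  simp only [e1, e2, e3]
  have hnd := le_integral_second_difference_norm A B hAB (m - xs) ((lam * t) • v) hp hAn
  have hmono : β * ∫ w, (‖m - xs + A w + (lam * t) • v‖ + ‖m - xs + A w - (lam * t) • v‖ -
      2 * ‖m - xs + A w‖) ∂(stdGaussian (Vec d)) ≤
      ∫ w, f (m + (lam * t) • v + A w) ∂(stdGaussian (Vec d)) +
        ∫ w, f (m - (lam * t) • v + A w) ∂(stdGaussian (Vec d)) -
        2 * ∫ w, f (m + A w) ∂(stdGaussian (Vec d)) := by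
    have h2i : ∫ w, (f (m + (lam * t) • v + A w) + f (m - (lam * t) • v + A w) -
        2 * f (m + A w)) ∂(stdGaussian (Vec d)) =
        ∫ w, f (m + (lam * t) • v + A w) ∂(stdGaussian (Vec d)) +
        ∫ w, f (m - (lam * t) • v + A w) ∂(stdGaussian (Vec d)) -
        2 * ∫ w, f (m + A w) ∂(stdGaussian (Vec d)) := by
      rw [integral_sub, integral_add (hi _) (hi _), integral_const_mul]
      exacts [(hi _).add (hi _), (hi _).const_mul _]
    rw [← h2i, ← integral_const_mul]
    refine integral_mono_of_nonneg (.of_forall fun w => ?_)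
      (((hi _).add (hi _)).sub ((hi _).const_mul _)) (.of_forall fun w => ?_)
    · exact mul_nonneg hβ.le (second_difference_norm_nonneg _ _)
    · have := hf.second_difference_le (m + A w) ((lam * t) • v)
      simp only
      rw [show m + (lam * t) • v + A w = m + A w + (lam * t) • v by abel,
        show m - (lam * t) • v + A w = m + A w - (lam * t) • v by abel,
        show m - xs + A w = m + A w - xs by abel]
      exact this
  have h6 := mul_le_mul_of_nonneg_left (mul_le_mul_of_nonneg_left hnd hβ.le)
    (one_div_pos.2 hlam0).le
  have h7 := mul_le_mul_of_nonneg_left hmono (one_div_pos.2 hlam0).le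
  refine le_trans (le_of_eq ?_) ((h6.trans h7).trans (le_of_eq (by ring)))
  rw [hBn (m - xs), map_smul, norm_smul, norm_smul, mul_pow, mul_pow, Real.norm_eq_abs, sq_abs,
    show normSqWrt P (m - xs) / (1 - lam) ^ 2 / 2 = normSqWrt P (m - xs) / (2 * (1 - lam) ^ 2) by
      field_simp,
    show (lam * t) ^ 2 * ‖B v‖ ^ 2 / 2 = lam ^ 2 * ‖B v‖ ^ 2 / 2 * t ^ 2 by ring]
  field_simp

/-! ### The growth recursion -/

theorem sum_Ico_two_cast {t : ℕ} (ht : 2 ≤ t) :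
    ∑ u ∈ Finset.Ico 2 t, (u : ℝ) = ((t : ℝ) ^ 2 - t - 2) / 2 := by
  induction t, ht using Nat.le_induction with
  | base => norm_num
  | succ t ht ih =>
    rw [Finset.sum_Ico_succ_top ht, ih]
    push_cast
    ring

/-- While `A t ≤ 16`, `(A t)^(2-κ) ≤ 256` and the initial term `s/2 ≥ 1/2` suffices. Afterwards the
sum takes over, compared with an arithmetic one through `M = A^(2-κ) t^(-κ)`, frozen at the final
time `t`. -/
theorem growth_recursion {A κ s : ℝ} (hA : 0 < A) (hκ0 : 0 < κ) (hκ : κ ≤ 1) {t : ℕ} (ht : 2 ≤ t)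
    (hs1 : 1 ≤ s) (hs : A ^ (2 - κ) / 32 ≤ s) :
    A ^ (2 - κ) / 512 * (t : ℝ) ^ (2 - κ) ≤
      s / 2 + A / 4 * ∑ u ∈ Finset.Ico 2 t, Real.sqrt (A ^ (2 - κ) / 512 * (u : ℝ) ^ (2 - κ)) := by
  rw [Finset.mul_sum]
  have ht2 : (2 : ℝ) ≤ t := by exact_mod_cast ht
  have ht0 : (0 : ℝ) < t := by linarith
  rcases le_total (A * t) 16 with h | h
  · have h1 : A ^ (2 - κ) * (t : ℝ) ^ (2 - κ) ≤ 256 := by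
      rw [← Real.mul_rpow hA.le ht0.le]
      calc (A * t) ^ (2 - κ) ≤ (16 : ℝ) ^ (2 - κ) :=
            Real.rpow_le_rpow (by positivity) h (by linarith)
        _ ≤ (16 : ℝ) ^ (2 : ℝ) := Real.rpow_le_rpow_of_exponent_le (by norm_num) (by linarith)
        _ = 256 := by norm_num
    have h2 : 0 ≤ ∑ u ∈ Finset.Ico 2 t,
        A / 4 * Real.sqrt (A ^ (2 - κ) / 512 * (u : ℝ) ^ (2 - κ)) :=
      Finset.sum_nonneg fun u _ => by positivity
    linarith
  · set D := A ^ (2 - κ) with hD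
    have hD0 : 0 < D := Real.rpow_pos_of_pos hA _
    set M := D * (t : ℝ) ^ (-κ) with hM
    have hM0 : 0 < M := by positivity
    have hMD : M ≤ D :=
      mul_le_of_le_one_right hD0.le (Real.rpow_le_one_of_one_le_of_nonpos (by linarith) (by linarith))
    have hsq : ∀ x : ℝ, 0 < x → x ^ (2 - κ) = x ^ 2 * x ^ (-κ) := fun x hx => by
      rw [sub_eq_add_neg, Real.rpow_add hx, Real.rpow_two]
    -- Here `A t ≥ 1` is needed: `M = A² (A t)^(-κ)`.
    have hA2 : M ≤ A ^ 2 := by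
      have h1 : 1 ≤ (A * t) ^ κ := Real.one_le_rpow (by linarith) hκ0.le
      rw [Real.mul_rpow hA.le ht0.le] at h1
      rw [hM, hD, hsq A hA, Real.rpow_neg hA.le, Real.rpow_neg ht0.le, mul_assoc, ← mul_inv]
      exact mul_le_of_le_one_right (by positivity) (inv_le_one_of_one_le₀ h1)
    have hterm : ∀ u ∈ Finset.Ico 2 t,
        M / 128 * u ≤ A / 4 * Real.sqrt (D / 512 * (u : ℝ) ^ (2 - κ)) := by
      intro u hu
      rw [Finset.mem_Ico] at hu
      have hu0 : (0 : ℝ) < u := by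
        have : 0 < u := by omega
        exact_mod_cast this
      have hut : (u : ℝ) ≤ t := by exact_mod_cast hu.2.le
      have h1 : (t : ℝ) ^ (-κ) ≤ (u : ℝ) ^ (-κ) :=
        Real.rpow_le_rpow_of_nonpos hu0 hut (by linarith)
      have h2 : M * (u : ℝ) ^ 2 ≤ D * (u : ℝ) ^ (2 - κ) := by
        rw [hsq _ hu0, hM, mul_assoc, mul_comm ((t : ℝ) ^ (-κ))]
        gcongr
      have h3 : M / 32 * u ≤ Real.sqrt (A ^ 2 * (D / 512 * (u : ℝ) ^ (2 - κ))) := by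
        refine Real.le_sqrt_of_sq_le ?_
        have h4 : M * (M * (u : ℝ) ^ 2) ≤ A ^ 2 * (D * (u : ℝ) ^ (2 - κ)) := by gcongr
        have h5 : 0 ≤ M * (M * (u : ℝ) ^ 2) := by positivity
        nlinarith
      rw [Real.sqrt_mul (by positivity), Real.sqrt_sq hA.le] at h3
      linarith
    have hsum := Finset.sum_le_sum hterm
    rw [← Finset.mul_sum, sum_Ico_two_cast ht] at hsum
    have hl : D / 512 * (t : ℝ) ^ (2 - κ) = M / 512 * (t : ℝ) ^ 2 := by
      rw [hsq _ ht0, hM]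
      ring
    rw [hl]
    -- With `s/2 ≥ D/64 ≥ M/64`, the surplus is at least `M ((t - 1)² + 3) / 512`.
    nlinarith [mul_nonneg hM0.le (sq_nonneg ((t : ℝ) - 1))]

/-! ### Constants, the stopping round and the induction -/

theorem four_mul_le_six_pow {d : ℕ} (hd : 1 ≤ d) : 4 * d ≤ 6 ^ d := by
  induction d, hd using Nat.le_induction with
  | base => norm_num
  | succ d hd ih => rw [pow_succ]; omega

/-- From `π ≤ 4` and `2√d ≤ 6^(d/2)`. -/
theorem six_rpow_le {d : ℕ} (hd : 1 ≤ d) :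
    (6 : ℝ) ^ (-((d : ℝ) / 2)) ≤ 2 / Real.pi / Real.sqrt d := by
  have hd0 : (0 : ℝ) < d := by exact_mod_cast hd
  have h1 : (6 : ℝ) ^ (-((d : ℝ) / 2)) = (Real.sqrt (6 ^ d))⁻¹ := by
    rw [Real.rpow_neg (by norm_num), Real.sqrt_eq_rpow, ← Real.rpow_natCast, ← Real.rpow_mul
      (by norm_num)]
    ring_nf
  have h2 : 2 * Real.sqrt d ≤ Real.sqrt (6 ^ d) := by
    refine Real.le_sqrt_of_sq_le ?_
    rw [mul_pow, Real.sq_sqrt hd0.le]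
    have := four_mul_le_six_pow hd
    have h3 : (4 * d : ℝ) ≤ 6 ^ d := by exact_mod_cast this
    linarith
  rw [h1, div_div, ← inv_div]
  refine inv_anti₀ (by positivity) ?_
  have := mul_le_mul_of_nonneg_right Real.pi_le_four (Real.sqrt_nonneg d)
  linarith

/-- The constant `lam β η 6^(-d/2) exp (-1/(lam² L²))`, whose power `2 - κ` drives the growth. -/
noncomputable def growthRate (d : ℕ) (lam β η L : ℝ) : ℝ :=
  lam * β * η * (6 : ℝ) ^ (-((d : ℝ) / 2)) * Real.exp (-(1 / (lam ^ 2 * L ^ 2)))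

theorem growthRate_pos (d : ℕ) {lam β η : ℝ} (L : ℝ) (hlam : 0 < lam) (hβ : 0 < β) (hη : 0 < η) :
    0 < growthRate d lam β η L := by
  unfold growthRate
  positivity

theorem growthConst_eq (d : ℕ) {lam β η : ℝ} (κ L : ℝ) (hlam : 0 < lam) (hβ : 0 < β)
    (hη : 0 < η) : growthConst d lam β η κ L = growthRate d lam β η L ^ (2 - κ) / 32 := by
  unfold growthConst growthRate
  rw [Real.mul_rpow (by positivity) (by positivity), Real.mul_rpow (by positivity) (by positivity),
    Real.mul_rpow (by positivity) (by positivity), Real.mul_rpow (by positivity) (by positivity),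
    ← Real.rpow_mul (by norm_num), ← Real.exp_mul]
  ring_nf

/-- Round `t - 1` precedes `τ` and monitors the state of round `t`; the initial state is never
monitored, whence `2 ≤ t`. -/
theorem good_of_le_stoppingRound {n : ℕ} {good : ℕ → Prop} {t : ℕ} (ht : 2 ≤ t)
    (h : t ≤ stoppingRound n good) : good t := by
  classical
  unfold stoppingRound at h
  split_ifs at h with hex
  · have h1 := Nat.find_min hex (m := t - 1) (by omega)
    have h2 := (Nat.find_spec hex).2.1
    by_contra hb
    exact h1 ⟨by omega, by omega, by rwa [show t - 1 + 1 = t by omega]⟩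
  · by_contra hb
    exact hex ⟨t - 1, by omega, by omega, by rwa [show t - 1 + 1 = t by omega]⟩

/-- The contribution of a good round to the precision matrix. -/
theorem growthRate_mul_sqrt_le {d : ℕ} {β G : ℝ} {f : Vec d → ℝ} {xs : Vec d}
    (hf : IsAdmissibleLoss β G f xs) {lam η L : ℝ} (hlam0 : 0 < lam)
    (hlam : lam ≤ 1 - 1 / Real.sqrt 2) (hη : 0 < η)
    {P : Mat d} (hP : P.PosDef) {p : ℝ} (hp : 0 < p)
    (hpP : ∀ v : Vec d, p * ‖v‖ ^ 2 ≤ normSqWrt P v) (m v : Vec d)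
    (hm : 1 / 2 * normSqWrt P (m - xs) ≤ 1 / (2 * lam ^ 2 * L ^ 2)) :
    growthRate d lam β η L * Real.sqrt p * ‖v‖ ^ 2 ≤
      η * normSqWrt (hessianMat (surrogate f lam m P⁻¹) m) v := by
  have hβ : 0 < β := hf.convex.1
  have hs2 : 0 < 1 / Real.sqrt 2 := by positivity
  -- The bound on `lam` serves here: the exponent is then at most `‖m - xs‖²_P`, which (a) controls.
  have hl2 : 1 ≤ 2 * (1 - lam) ^ 2 := by
    have h1 : (1 / Real.sqrt 2) ^ 2 = 1 / 2 := by
      rw [div_pow, Real.sq_sqrt (by norm_num), one_pow]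
    have h2 : (1 / Real.sqrt 2) ^ 2 ≤ (1 - lam) ^ 2 := by
      gcongr
      linarith
    linarith
  have hH := le_normSqWrt_hessianMat_surrogate hf hlam0 (by linarith) hP hp hpP m v
  refine le_trans ?_ (mul_le_mul_of_nonneg_left hH hη.le)
  -- In dimension `0` the comparison of constants fails, but every vector is zero.
  rcases Nat.eq_zero_or_pos d with rfl | hd
  · rw [Subsingleton.elim v 0]
    simp
  have hN := hP.posSemidef.normSqWrt_nonneg (m - xs)
  have he : normSqWrt P (m - xs) / (2 * (1 - lam) ^ 2) ≤ 1 / (lam ^ 2 * L ^ 2) := by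
    have h1 : normSqWrt P (m - xs) / (2 * (1 - lam) ^ 2) ≤ normSqWrt P (m - xs) :=
      div_le_self hN hl2
    have h2 : 1 / (2 * lam ^ 2 * L ^ 2) = 1 / 2 * (1 / (lam ^ 2 * L ^ 2)) := by
      rw [mul_assoc, one_div_mul_one_div]
    rw [h2] at hm
    linarith
  calc growthRate d lam β η L * Real.sqrt p * ‖v‖ ^ 2
      = η * (β * lam * (6 : ℝ) ^ (-((d : ℝ) / 2)) * Real.sqrt p *
          Real.exp (-(1 / (lam ^ 2 * L ^ 2))) * ‖v‖ ^ 2) := by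
        unfold growthRate
        ring
    _ ≤ _ := by
        gcongr
        exact six_rpow_le hd

theorem mainTheorem7 {d n : ℕ} {Ω : Type*} [MeasurableSpace Ω] (Pr : MeasureTheory.Measure Ω)
    [MeasureTheory.IsProbabilityMeasure Pr]
    (f : Vec d → ℝ) (xs : Vec d) (β G : ℝ) (hf : IsAdmissibleLoss β G f xs)
    (lam η σ L κ : ℝ)
    (hlam_pos : 0 < lam) (hlam : lam ≤ 1 - 1 / Real.sqrt 2)
    (hη : 0 < η) (hσ : 0 < σ) (hL : 0 < L) (hκ_pos : 0 < κ) (hκ : κ ≤ 1)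
    (hσΘ : max (growthConst d lam β η κ L) 1 ≤ (σ ^ 2)⁻¹)
    (X : ℕ → Ω → Vec d) (ε : ℕ → Ω → ℝ) (hrun : IsNewtonRun Pr f xs lam η σ n X ε) :
    ∀ ω : Ω, ∀ t : ℕ, 1 ≤ t →
      t ≤ stoppingRound n (GoodState f xs lam η σ L (stateProc f lam η σ X ε ω)) →
      LoewnerLE ((growthConst d lam β η κ L / 16 * (t : ℝ) ^ (2 - κ)) • (1 : Mat d))
        (stateProc f lam η σ X ε ω t).prec := by
  intro ω t
  have hβ : 0 < β := hf.convex.1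
  set st := stateProc f lam η σ X ε ω with hst
  have hst1 : (st 1).prec = (σ ^ 2)⁻¹ • (1 : Mat d) := rfl
  have hσ0 : 0 < (σ ^ 2)⁻¹ := by positivity
  have hP1 : (st 1).prec.PosDef := by
    rw [hst1]
    exact Matrix.PosDef.one.smul hσ0
  have hN1 : ∀ v, normSqWrt (st 1).prec v = (σ ^ 2)⁻¹ * ‖v‖ ^ 2 := fun v => by
    rw [hst1, normSqWrt_smul, normSqWrt_one]
  set A := growthRate d lam β η L with hA
  have hA0 : 0 < A := growthRate_pos d L hlam_pos hβ hη
  have hΘ : growthConst d lam β η κ L = A ^ (2 - κ) / 32 := growthConst_eq d κ L hlam_pos hβ hη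
  have hD0 : 0 < A ^ (2 - κ) := Real.rpow_pos_of_pos hA0 _
  rw [hΘ] at hσΘ ⊢
  have hs1 := (le_max_right _ _).trans hσΘ
  have hsD := (le_max_left _ _).trans hσΘ
  rw [show A ^ (2 - κ) / 32 / 16 = A ^ (2 - κ) / 512 by ring]
  induction t using Nat.strong_induction_on with
  | _ t ih =>
  intro ht hτ
  rcases eq_or_lt_of_le ht with rfl | ht2
  · refine loewnerLE_smul_one_of_forall hP1.1 fun v => ?_
    rw [hN1]
    refine mul_le_mul_of_nonneg_right ?_ (sq_nonneg _)
    rw [Nat.cast_one, Real.one_rpow]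
    linarith
  obtain ⟨-, hPt, hlow, -⟩ := good_of_le_stoppingRound ht2 hτ
  refine loewnerLE_smul_one_of_forall hPt.1 fun v => ?_
  refine le_trans ?_ (hlow.normSqWrt_le v)
  rw [normSqWrt_smul, meanPrec, normSqWrt_add, normSqWrt_smul, normSqWrt_one, normSqWrt_smul,
    normSqWrt_sum, Finset.sum_eq_sum_Ico_succ_bot (by omega)]
  -- Condition (a) is not monitored at the initial state, so round `1` contributes only a
  -- nonnegative Hessian and the recursion sums from `2`.
  have hfirst : 0 ≤ normSqWrt (hessianMat (surrogate f lam (st 1).mean (st 1).prec⁻¹)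
      (st 1).mean) v := by
    refine le_trans ?_ (le_normSqWrt_hessianMat_surrogate hf hlam_pos ?_ hP1 hσ0
      (fun v => (hN1 v).ge) (st 1).mean v)
    · positivity
    · have : 0 < 1 / Real.sqrt 2 := by positivity
      linarith
  have hrest : ∀ u ∈ Finset.Ico (1 + 1) t,
      A * Real.sqrt (A ^ (2 - κ) / 512 * (u : ℝ) ^ (2 - κ)) * ‖v‖ ^ 2 ≤
      η * normSqWrt (hessianMat (surrogate f lam (st u).mean (st u).prec⁻¹) (st u).mean) v := by
    intro u hu
    rw [Finset.mem_Ico] at hu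
    have hu0 : (0 : ℝ) < u := by
      have : 0 < u := by omega
      exact_mod_cast this
    obtain ⟨hm, hPu, -, -⟩ := good_of_le_stoppingRound hu.1 (hu.2.le.trans hτ)
    have hLu := ih u hu.2 (by omega) (hu.2.le.trans hτ)
    refine growthRate_mul_sqrt_le hf hlam_pos hlam hη hPu (by positivity) (fun w => ?_) _ v hm
    have := hLu.normSqWrt_le w
    rwa [normSqWrt_smul, normSqWrt_one] at this
  have hsum := Finset.sum_le_sum hrest
  rw [← Finset.mul_sum, ← Finset.sum_mul, ← Finset.mul_sum] at hsum
  have hgr := mul_le_mul_of_nonneg_right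
    (growth_recursion hA0 hκ_pos hκ ht2 hs1 hsD) (sq_nonneg ‖v‖)
  have hη1 := mul_nonneg hη.le hfirst
  linarith
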